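/- Let $\mathfrak g_0$ be a Euclidean space of finite dimension $n$, let $L:\mathfrak g_0\to\mathfrak g_0$ be a linear operator, and let $G=\mathfrak g_0\rtimes\mathbb R$ be the Lie group with the law $(w,u)(w',u')=(w+e^{uL}w',u+u')$. Let $\Gamma_0\subset\mathfrak g_0$ be a lattice of rank $n$, put $M=\Gamma_0\backslash G$, and identify $TM$, by left translations, with $(\mathfrak g_0/\Gamma_0)\times\mathbb R\times\mathfrak g_0\times\mathbb R$, with the coordinates $(w,u;\xi,\eta)$. The $L$-$F$ system of a vector field $F$ on $\mathfrak g_0$ is the flow on $TM$ of $$\dot\xi=\eta F(\xi),\quad \dot\eta=-\langle F(\xi),\xi\rangle,\quad \dot w=e^{uL}\xi,\quad \dot u=\eta .$$ It preserves the energy $|\xi|^2+\eta^2$, hence the unit sphere bundle $SM=\{|\xi|^2+\eta^2=1\}$, on which it depends only on $F$ restricted to the closed unit ball $\bar B\subset\mathfrak g_0$. It is called quadratic if $F$ is linear. Let $1\le r\le\infty$. The system is called integrable (with tori of class $C^r$) on the phase space $TM$ or $SM$ if an open dense subset of that space is the union of pairwise disjoint invariant $(n+1)$-dimensional tori, embedded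 with class $C^r$, on each of which the motion is quasi-periodic, i.e. in suitable angle coordinates $\theta\in\mathbb T^{n+1}$ the flow is $\theta\mapsto\theta+t\omega$ with a constant vector $\omega$ (no rational independence is required). Theorem 6.2. Let $F$ be a linear operator on $\mathfrak g_0$ that has a (complex) eigenvalue with positive real part and a (complex) eigenvalue with negative real part. (1) For all $L$ and $\Gamma_0$ the flow of the quadratic $L$-$F$ system on $TM$ exists for all times and is integrable, with tori of class $C^\infty$. The functions $e^{-uF}\xi$ ($n$ components) and $|\xi|^2+\eta^2$ are real-analytic first integrals. The tori can be chosen so that each of them is a connected component of a common level set of these first integrals, and each common level set that meets one of the tori is the union of finitely many of them. (2) There is $\varepsilon>0$, which depends only on $F$, such that the following holds for all $1\le r\le\infty$, all $L$, all $\Gamma_0$ and every vector field $H$. If $H:\mathfrak g_0\to\mathfrak g_0$ is of class $C^r$ and $$|H(\xi)-F\xi|<\varepsilon(1+|\xi|),\qquad \|DH(\xi)-F\|<\varepsilon$$ for all $\xi\in\mathfrak g_0$, then the flow of the $L$-$H$ system on $TM$ exists for all times and is integrable with tori of class $C^r$. If $H$ is of class $C^r$ on the closed unit ball $\bar B$ and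 these inequalities hold for all $\xi\in\bar B$, then the flow of the $L$-$H$ system on $SM$ exists for all times and is integrable with tori of class $C^r$. -/

import Mathlib

open Set Topology

noncomputable section

namespace LF

variable {E : Type*} [NormedAddCommGroup E] [InnerProductSpace ℝ E]

/-! Throughout, `E` is the Euclidean space `𝔤₀` (the abelian ideal), `L : E → E` is the linear
operator `ad_b`, and `G = E ⋊ ℝ` is the Lie group with the law
`(w, u) (w', u') = (w + exp (u L) w', u + u')` and the Lie algebra `𝔤 = 𝔤₀ ⊕ ℝ b`. -/

/-- The tangent bundle `TG = G × 𝔤`, trivialized by left translations, in the coordinates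
`(w, u, ξ, η)`. -/
abbrev TG (E : Type*) := E × ℝ × E × ℝ

/-- The tangent bundle `TM` of `M = Γ \ G`. Left translation by `γ ∈ Γ ⊆ G₀` is
`(w, u) ↦ (γ + w, u)`, and it acts trivially on the Lie algebra factor; hence
`TM = (E / Γ) × ℝ × E × ℝ`. -/
abbrev TM (Γ : Submodule ℤ E) := (E ⧸ Γ) × ℝ × E × ℝ

/-- The covering map `TG → TM`. -/
def proj (Γ : Submodule ℤ E) (p : TG E) : TM Γ :=
  (Submodule.Quotient.mk p.1, p.2.1, p.2.2.1, p.2.2.2)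

/-- The energy `|ξ|² + η²`, the squared length of the velocity, on `TM`. -/
def energy (Γ : Submodule ℤ E) (p : TM Γ) : ℝ := ‖p.2.2.1‖ ^ 2 + p.2.2.2 ^ 2

/-- The unit sphere bundle `SM`. -/
def SM (Γ : Submodule ℤ E) : Set (TM Γ) := {p | energy Γ p = 1}

/-- The vector field of the `L`-`F` system on `TG`:
`w' = exp (u L) ξ`, `u' = η`, `ξ' = η F(ξ)`, `η' = -⟨F(ξ), ξ⟩`. -/
def field (L : E →L[ℝ] E) (F : E → E) (p : TG E) : TG E :=
  (NormedSpace.exp (p.2.1 • L) p.2.2.1, p.2.2.2,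
    p.2.2.2 • F p.2.2.1, -inner ℝ (F p.2.2.1) p.2.2.1)

/-- `Ψ` is the `L`-`F` system on the phase space `P` (which is `TM`, i.e. `Set.univ`, or `SM`):
the orbits of the flow `Ψ` are the projections of the integral curves of the vector field. -/
def IsLFFlow (Γ : Submodule ℤ E) (L : E →L[ℝ] E) (F : E → E) (P : Set (TM Γ))
    (Ψ : Flow ℝ P) : Prop :=
  ∀ (p : TG E) (hp : proj Γ p ∈ P), ∃ c : ℝ → TG E, c 0 = p ∧
    (∀ t, HasDerivAt c (field L F (c t)) t) ∧
    ∀ t, (Ψ t ⟨proj Γ p, hp⟩ : TM Γ) = proj Γ (c t)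

/-- `T` is an invariant `(n + 1)`-dimensional torus, `n = dim E`, embedded with class `C^r`, which
carries a quasi-periodic motion: in suitable angle coordinates the flow on `T` is the linear flow
`θ ↦ θ + t ω`. The regularity and the immersivity of the embedding are expressed through a lift to
the universal covers `ℝ^(n + 1)` of the torus and `TG` of `TM`. -/
def IsQuasiPeriodicTorus (r : ℕ∞) (Γ : Submodule ℤ E) (P : Set (TM Γ)) (Ψ : Flow ℝ P)
    (T : Set P) : Prop :=
  ∃ (e : (Fin (Module.finrank ℝ E + 1) → UnitAddCircle) → P)
    (lift : (Fin (Module.finrank ℝ E + 1) → ℝ) → TG E)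
    (ω : Fin (Module.finrank ℝ E + 1) → ℝ),
    IsEmbedding e ∧ range e = T ∧
    ContDiff ℝ r lift ∧ (∀ x, Function.Injective (fderiv ℝ lift x)) ∧
    (∀ x, (e (fun i => (x i : UnitAddCircle)) : TM Γ) = proj Γ (lift x)) ∧
    ∀ t θ, Ψ t (e θ) = e (fun i => θ i + ((t * ω i : ℝ) : UnitAddCircle))

/-- The pairwise disjoint sets of the family `𝒯` are invariant tori with quasi-periodic motions,
and they fill an open dense subset of the phase space. -/
structure IsTorusFamily (r : ℕ∞) (Γ : Submodule ℤ E) (P : Set (TM Γ)) (Ψ : Flow ℝ P)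
    (𝒯 : Set (Set P)) : Prop where
  torus : ∀ T ∈ 𝒯, IsQuasiPeriodicTorus r Γ P Ψ T
  disjoint : 𝒯.PairwiseDisjoint id
  isOpen : IsOpen (⋃₀ 𝒯)
  dense : Dense (⋃₀ 𝒯)

/-- Integrability (with tori of class `C^r`): an open dense subset of the phase space is filled
with invariant tori carrying quasi-periodic motions. -/
def IsIntegrable (r : ℕ∞) (Γ : Submodule ℤ E) (P : Set (TM Γ)) (Ψ : Flow ℝ P) : Prop :=
  ∃ 𝒯 : Set (Set P), IsTorusFamily r Γ P Ψ 𝒯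

/-- The vector valued function `exp (-u F) ξ` on `TM`. -/
def firstIntegral (Γ : Submodule ℤ E) (F : E →L[ℝ] E) (p : TM Γ) : E :=
  NormedSpace.exp (-p.2.1 • F) p.2.2.1

/-- The common level set of `exp (-u F) ξ` and the energy through `p`. -/
def levelSet (Γ : Submodule ℤ E) (F : E →L[ℝ] E) {P : Set (TM Γ)} (p : P) : Set P :=
  {q | firstIntegral Γ F q = firstIntegral Γ F p ∧ energy Γ q = energy Γ p}

/-- `H` is `ε`-close to the linear vector field `F` on `D` in the `C^1` sense. The weight `1 + |x|`
matters only for unbounded `D`, where it admits small linear perturbations. -/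
def IsC1Close (ε : ℝ) (D : Set E) (F : E →L[ℝ] E) (H : E → E) : Prop :=
  ∀ x ∈ D, ‖H x - F x‖ < ε * (1 + ‖x‖) ∧ ‖fderivWithin ℝ H D x - F‖ < ε

/-- `z` is an eigenvalue of the complexification of `F`. -/
def IsComplexEigenvalue (F : E →L[ℝ] E) (z : ℂ) : Prop :=
  Module.End.HasEigenvalue ((F : E →ₗ[ℝ] E).baseChange ℂ) z

end LF

end

/-!
The vector field of the `L`-`F` system does not depend on the component `w`, so the flow on `TM` is a
skew product over the flow of the reduced system `u' = η`, `ξ' = η F(ξ)`, `η' = -⟨F(ξ), ξ⟩` for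
`b = (u, ξ, η)`. Let `Φ` be the flow of `F` on `𝔤₀`. Then `ξ` moves along an orbit of `Φ` with the time
parameter `u`, i.e. `ξ(t) = Φ^{u(t) - u(0)} ξ(0)`, and by the conservation of the energy `h` the
displacement `s = u - u(0)` solves the Newton equation with the potential `|Φ^s ξ(0)|²` on the energy
level `h`. Suppose that `Φ^s ξ(0)` leaves the ball of radius `√h` both for positive and for negative
`s`, and is not tangent to its boundary until then (`IsConfined`). Then `s` oscillates between two
turning points, and the reduced orbit is periodic (`IsConfined.exists_period`). Over a periodic orbit,
the motion of `w` is a translation by a fixed vector after each period. Since `𝔤₀ / Γ₀` is a torus, this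
gives an invariant torus with a quasi-periodic motion (`isQuasiPeriodicTorus_orbitTorus`). Its
regularity is that of a single solution, so a global Lipschitz bound on `F` and `C^r` regularity where
the orbit runs are sufficient.

The confined points form an open invariant set. That it is dense rests on two facts. The orbits of `Φ`
that are tangent to a given sphere form a null set (`dense_not_tangent`). This holds for Lipschitz vector
fields, as during a time `δ` the set of tangency points sweeps out a set of measure `O(δ²)`. Moreover,
for every ball, the orbits that leave it are dense (`exists_forall_dense_escape`). For this, one uses a
quadratic form `B`, positive somewhere, that grows exponentially along the differences of orbits: an
eigenvalue with positive real part and a generic shift yield `B(Fx, x) ≥ μ B(x, x) + c |x|²` with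
`μ, c > 0`, an inequality that persists under small Lipschitz perturbations. The eigenvalue with negative
real part serves the opposite direction of time. A perturbation that is small on the unit ball
only is first extended to the whole space.

For linear `F`, left eigenvectors show more directly that the orbits escape, and do so locally
uniformly. Hence the level sets of the first integrals are compact modulo `Γ₀` over an open dense set
(`regularSet`). Every torus in such a level set is relatively open and closed in it, so it is a
connected component, and by compactness there are finitely many of them.
-/

noncomputable section

set_option linter.unusedSectionVars false

namespace LF

/-! ### Global flows of Lipschitz vector fields -/

section LipschitzFlow

variable {V : Type*} [NormedAddCommGroup V] [NormedSpace ℝ V]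

/-- The radial retraction of a normed space onto the closed ball of radius `R` about `0`. -/
def radialRetraction (R : ℝ) (x : V) : V := (R / max R ‖x‖) • x

lemma radialRetraction_of_norm_le {R : ℝ} (hR : 0 < R) {x : V} (hx : ‖x‖ ≤ R) :
    radialRetraction R x = x := by
  rw [radialRetraction, max_eq_left hx, div_self hR.ne', one_smul]

lemma norm_radialRetraction_le_norm {R : ℝ} (hR : 0 < R) (x : V) :
    ‖radialRetraction R x‖ ≤ ‖x‖ := by
  rw [radialRetraction, norm_smul, Real.norm_of_nonneg (by positivity)]
  exact mul_le_of_le_one_left (norm_nonneg x)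
    ((div_le_one (lt_max_of_lt_left hR)).2 (le_max_left _ _))

lemma norm_radialRetraction_le {R : ℝ} (hR : 0 < R) (x : V) :
    ‖radialRetraction R x‖ ≤ R := by
  have hm : 0 < max R ‖x‖ := lt_max_of_lt_left hR
  rw [radialRetraction, norm_smul, Real.norm_of_nonneg (by positivity), div_mul_eq_mul_div,
    div_le_iff₀ hm]
  gcongr
  exact le_max_right _ _

lemma lipschitzWith_radialRetraction {R : ℝ} (hR : 0 < R) :
    LipschitzWith 2 (radialRetraction R : V → V) := by
  refine LipschitzWith.of_dist_le_mul fun x y => ?_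
  have hx : 0 < max R ‖x‖ := lt_max_of_lt_left hR
  have hy : 0 < max R ‖y‖ := lt_max_of_lt_left hR
  have h1 : R / max R ‖x‖ ≤ 1 := (div_le_one hx).2 (le_max_left _ _)
  have h2 : |max R ‖y‖ - max R ‖x‖| ≤ ‖x - y‖ := by
    refine (abs_max_sub_max_le_max _ _ _ _).trans ?_
    rw [sub_self, abs_zero, max_eq_right (abs_nonneg _), abs_sub_comm]
    exact abs_norm_sub_norm_le x y
  have h3 : ‖y‖ / max R ‖y‖ ≤ 1 := (div_le_one hy).2 (le_max_right _ _)
  have hkey : radialRetraction R x - radialRetraction R y =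
      (R / max R ‖x‖) • (x - y) +
        ((R / max R ‖x‖) * ((max R ‖y‖ - max R ‖x‖) / max R ‖y‖)) • y := by
    have : (R / max R ‖x‖) * ((max R ‖y‖ - max R ‖x‖) / max R ‖y‖) =
        R / max R ‖x‖ - R / max R ‖y‖ := by field_simp
    rw [this, radialRetraction, radialRetraction, smul_sub, sub_smul]
    abel
  rw [dist_eq_norm, dist_eq_norm, hkey]
  refine (norm_add_le _ _).trans ?_
  rw [norm_smul, norm_smul, Real.norm_of_nonneg (by positivity), norm_mul,
    Real.norm_of_nonneg (by positivity : 0 ≤ R / max R ‖x‖), norm_div,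
    Real.norm_of_nonneg hy.le, Real.norm_eq_abs]
  have h4 : R / max R ‖x‖ * (|max R ‖y‖ - max R ‖x‖| / max R ‖y‖) * ‖y‖ ≤ ‖x - y‖ := by
    calc R / max R ‖x‖ * (|max R ‖y‖ - max R ‖x‖| / max R ‖y‖) * ‖y‖
        = R / max R ‖x‖ * |max R ‖y‖ - max R ‖x‖| * (‖y‖ / max R ‖y‖) := by ring
      _ ≤ 1 * ‖x - y‖ * 1 := by gcongr
      _ = ‖x - y‖ := by ring
  have h5 : R / max R ‖x‖ * ‖x - y‖ ≤ ‖x - y‖ := mul_le_of_le_one_left (norm_nonneg _) h1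
  push_cast
  linarith

/-- Integral curves on all bounded intervals can be glued to a global one. -/
lemma exists_integralCurve_of_forall_Ioo {X : V → V} {K : NNReal} (hX : LipschitzWith K X) (x : V)
    (h : ∀ T > 0, ∃ c : ℝ → V, c 0 = x ∧ ∀ t ∈ Ioo (-T) T, HasDerivAt c (X (c t)) t) :
    ∃ c : ℝ → V, c 0 = x ∧ ∀ t, HasDerivAt c (X (c t)) t := by
  choose! γ h0 hγ using h
  have hagree : ∀ S T : ℝ, 0 < S → S ≤ T → EqOn (γ S) (γ T) (Ioo (-S) S) := by
    intro S T hS hST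
    refine ODE_solution_unique_of_mem_Ioo (v := fun _ => X) (s := fun _ => univ) (t₀ := 0)
      (fun t _ => hX.lipschitzOnWith) ⟨by linarith, hS⟩ (fun t ht => ⟨hγ S hS t ht, trivial⟩)
      (fun t ht => ⟨hγ T (by linarith) t ⟨by linarith [ht.1], by linarith [ht.2]⟩, trivial⟩) ?_
    rw [h0 S hS, h0 T (by linarith)]
  have heq : ∀ T : ℝ, ∀ t ∈ Ioo (-T) T, γ (|t| + 1) t = γ T t := by
    intro T t ht
    have hT : |t| < T := abs_lt.2 ht
    have h1 : t ∈ Ioo (-(|t| + 1)) (|t| + 1) := abs_lt.1 (by linarith)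
    rcases le_total (|t| + 1) T with h | h
    · exact hagree _ _ (by positivity) h h1
    · exact (hagree _ _ ((abs_nonneg t).trans_lt hT) h ht).symm
  refine ⟨fun t => γ (|t| + 1) t, by simpa using h0 1 one_pos, fun t => ?_⟩
  have h1 : t ∈ Ioo (-(|t| + 1)) (|t| + 1) := abs_lt.1 (by linarith)
  refine (hγ (|t| + 1) (by positivity) t h1).congr_of_eventuallyEq ?_
  filter_upwards [Ioo_mem_nhds h1.1 h1.2] with s hs using heq _ s hs

lemma exists_integralCurve_of_bounded [CompleteSpace V] {X : V → V} {K : NNReal} (hX : LipschitzWith K X)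
    {B : ℝ} (hB : ∀ x, ‖X x‖ ≤ B) (x : V) :
    ∃ c : ℝ → V, c 0 = x ∧ ∀ t, HasDerivAt c (X (c t)) t := by
  refine exists_integralCurve_of_forall_Ioo hX x fun T hT => ?_
  have hB0 : 0 ≤ B := (norm_nonneg _).trans (hB 0)
  have hP : IsPicardLindelof (fun _ => X) (tmin := -T) (tmax := T)
      ⟨0, by constructor <;> linarith⟩ x (⟨B * T, by positivity⟩ : NNReal) 0 ⟨B, hB0⟩ K :=
    { lipschitzOnWith := fun t _ => hX.lipschitzOnWith
      continuousOn := fun y _ => continuousOn_const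
      norm_le := fun t _ y _ => hB y
      mul_max_le := by
        change B * max (T - 0) (0 - -T) ≤ B * T - 0
        simp }
  obtain ⟨c, hc0, hc⟩ := hP.exists_eq_forall_mem_Icc_hasDerivWithinAt₀
  exact ⟨c, hc0, fun t ht => (hc t (Ioo_subset_Icc_self ht)).hasDerivAt (Icc_mem_nhds ht.1 ht.2)⟩

lemma norm_le_of_linear_growth {c c' : ℝ → V} {A K : ℝ} (hA : 0 ≤ A) (hK : 0 ≤ K)
    (hc : ∀ t, HasDerivAt c (c' t) t) (hb : ∀ t, ‖c' t‖ ≤ K * ‖c t‖ + A) {T t : ℝ} (ht : |t| ≤ T) :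
    ‖c t‖ ≤ gronwallBound ‖c 0‖ K A T := by
  have key : ∀ c c' : ℝ → V, (∀ t, HasDerivAt c (c' t) t) → (∀ t, ‖c' t‖ ≤ K * ‖c t‖ + A) →
      ∀ t, 0 ≤ t → t ≤ T → ‖c t‖ ≤ gronwallBound ‖c 0‖ K A T := by
    intro c c' hc hb t ht0 htT
    have hcont : Continuous c := continuous_iff_continuousAt.2 fun s => (hc s).continuousAt
    have := norm_le_gronwallBound_of_norm_deriv_right_le (f := c) (f' := c') (δ := ‖c 0‖)
      (K := K) (ε := A) (a := 0) (b := t) hcont.continuousOn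
      (fun s _ => (hc s).hasDerivWithinAt) le_rfl (fun s _ => hb s) t ⟨ht0, le_rfl⟩
    rw [sub_zero] at this
    exact this.trans (gronwallBound_mono (norm_nonneg _) hA hK htT)
  rcases le_total 0 t with h | h
  · exact key c c' hc hb t h (by rwa [abs_of_nonneg h] at ht)
  · have := key (fun s => c (-s)) (fun s => -c' (-s))
      (fun s => by simpa [Function.comp_def] using (hc (-s)).scomp s (hasDerivAt_neg s))
      (fun s => by simpa using hb (-s)) (-t) (by linarith) (by rwa [abs_of_nonpos h] at ht)
    simpa using this

lemma exists_integralCurve [CompleteSpace V] {X : V → V} {K : NNReal} (hX : LipschitzWith K X) (x : V) :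
    ∃ c : ℝ → V, c 0 = x ∧ ∀ t, HasDerivAt c (X (c t)) t := by
  refine exists_integralCurve_of_forall_Ioo hX x fun T hT => ?_
  have hgrow : ∀ y, ‖X y‖ ≤ K * ‖y‖ + ‖X 0‖ := fun y => by
    have := hX.dist_le_mul y 0
    rw [dist_eq_norm, dist_zero_right] at this
    have h2 := norm_sub_norm_le (X y) (X 0)
    linarith
  set R := max 1 (gronwallBound ‖x‖ K ‖X 0‖ T)
  have hR : 0 < R := lt_max_of_lt_left one_pos
  obtain ⟨c, hc0, hc⟩ := exists_integralCurve_of_bounded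
    (X := X ∘ radialRetraction R) (hX.comp (lipschitzWith_radialRetraction hR)) (B := K * R + ‖X 0‖)
    (fun y => (hgrow _).trans (by gcongr; exact norm_radialRetraction_le hR y)) x
  refine ⟨c, hc0, fun t ht => ?_⟩
  have hb : ‖c t‖ ≤ R := by
    refine (norm_le_of_linear_growth (norm_nonneg (X 0)) K.coe_nonneg hc (fun s => (hgrow _).trans ?_)
      (abs_lt.2 ht).le).trans ?_
    · exact add_le_add (mul_le_mul_of_nonneg_left (norm_radialRetraction_le_norm hR (c s))
        K.coe_nonneg) le_rfl
    · rw [hc0]; exact le_max_right _ _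
  have := hc t
  rwa [Function.comp_apply, radialRetraction_of_norm_le hR hb] at this

lemma integralCurve_unique {X : V → V} {K : NNReal} (hX : LipschitzWith K X) {c d : ℝ → V}
    (hc : ∀ t, HasDerivAt c (X (c t)) t) (hd : ∀ t, HasDerivAt d (X (d t)) t) {t₀ : ℝ}
    (h : c t₀ = d t₀) : c = d :=
  ODE_solution_unique_univ (v := fun _ => X) (s := fun _ => univ)
    (fun _ => hX.lipschitzOnWith) (fun t => ⟨hc t, trivial⟩) (fun t => ⟨hd t, trivial⟩) h

lemma dist_integralCurve_le {X : V → V} {K : NNReal} (hX : LipschitzWith K X) {c d : ℝ → V}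
    (hc : ∀ t, HasDerivAt c (X (c t)) t) (hd : ∀ t, HasDerivAt d (X (d t)) t) (t : ℝ) :
    dist (c t) (d t) ≤ dist (c 0) (d 0) * Real.exp (K * |t|) := by
  have key : ∀ {X : V → V}, LipschitzWith K X → ∀ {c d : ℝ → V},
      (∀ t, HasDerivAt c (X (c t)) t) → (∀ t, HasDerivAt d (X (d t)) t) → ∀ t, 0 ≤ t →
      dist (c t) (d t) ≤ dist (c 0) (d 0) * Real.exp (K * t) := by
    intro X hX c d hc hd t ht
    have := dist_le_of_trajectories_ODE (v := fun _ => X) (K := K) (f := c) (g := d) (a := 0)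
      (b := t) (fun _ => hX)
      (continuous_iff_continuousAt.2 fun s => (hc s).continuousAt).continuousOn
      (fun s _ => (hc s).hasDerivWithinAt)
      (continuous_iff_continuousAt.2 fun s => (hd s).continuousAt).continuousOn
      (fun s _ => (hd s).hasDerivWithinAt) le_rfl t ⟨ht, le_rfl⟩
    simpa using this
  rcases le_total 0 t with h | h
  · rw [abs_of_nonneg h]; exact key hX hc hd t h
  · have := key (X := fun x => -X x) hX.neg (c := fun s => c (-s)) (d := fun s => d (-s))
      (fun s => by simpa [Function.comp_def] using (hc (-s)).scomp s (hasDerivAt_neg s))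
      (fun s => by simpa [Function.comp_def] using (hd (-s)).scomp s (hasDerivAt_neg s)) (-t) (by linarith)
    simpa [abs_of_nonpos h] using this

/-- The flow of a Lipschitz vector field. -/
lemma exists_flow_of_lipschitz [CompleteSpace V] {X : V → V} {K : NNReal} (hX : LipschitzWith K X) :
    ∃ φ : Flow ℝ V, (∀ x t, HasDerivAt (fun s => φ s x) (X (φ t x)) t) ∧
      ∀ t x y, dist (φ t x) (φ t y) ≤ dist x y * Real.exp (K * |t|) := by
  choose c hc0 hc using exists_integralCurve hX
  have hdist : ∀ t x y, dist (c x t) (c y t) ≤ dist x y * Real.exp (K * |t|) := fun t x y => by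
    simpa [hc0] using dist_integralCurve_le hX (hc x) (hc y) t
  refine ⟨⟨fun t x => c x t, ?_, ?_, hc0⟩, hc, hdist⟩
  · refine continuous_iff_continuousAt.2 fun ⟨t, x⟩ => ?_
    rw [ContinuousAt, tendsto_iff_dist_tendsto_zero]
    have h1 : Filter.Tendsto (fun p : ℝ × V => dist p.2 x * Real.exp (K * |p.1|) +
        dist (c x p.1) (c x t)) (𝓝 (t, x)) (𝓝 (dist x x * Real.exp (K * |t|) +
        dist (c x t) (c x t))) := by
      have hcx : Continuous (c x) := continuous_iff_continuousAt.2 fun s => (hc x s).continuousAt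
      exact (Continuous.tendsto (by fun_prop) (t, x))
    rw [dist_self, dist_self, zero_mul, zero_add] at h1
    refine squeeze_zero (fun _ => dist_nonneg) (fun p => ?_) h1
    exact (dist_triangle _ (c x p.1) _).trans (add_le_add (hdist _ _ _) le_rfl)
  · intro s t x
    have : (fun s => c x (s + t)) = c (c x t) :=
      integralCurve_unique hX (t₀ := 0) (fun s => (hc x (s + t)).comp_add_const s t)
        (hc _) (by simp [hc0])
    exact congrFun this s

end LipschitzFlow

/-! ### The reduced system -/

section ReducedFlow

variable {E : Type*} [NormedAddCommGroup E] [InnerProductSpace ℝ E]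

/-- The reduced system `u' = η`, `ξ' = η H(ξ)`, `η' = -⟨H(ξ), ξ⟩` on `ℝ × E × ℝ`, which is obtained
from the `L`-`H` system by dropping the component `w`. -/
def reducedField (H : E → E) (b : ℝ × E × ℝ) : ℝ × E × ℝ :=
  (b.2.2, b.2.2 • H b.2.1, -inner ℝ (H b.2.1) b.2.1)

/-- The energy `|ξ|² + η²` on the reduced phase space. -/
def reducedEnergy (b : ℝ × E × ℝ) : ℝ := ‖b.2.1‖ ^ 2 + b.2.2 ^ 2

/-- The reduced field with `(ξ, η)` replaced by its retraction to the ball of radius `R`. It is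
globally Lipschitz, it preserves the energy, and it is the reduced field where the energy is at most
`R²`. -/
def truncatedField (H : E → E) (R : ℝ) (b : ℝ × E × ℝ) : ℝ × E × ℝ :=
  reducedField H (b.1, radialRetraction R b.2)

lemma continuous_reducedEnergy : Continuous (reducedEnergy : ℝ × E × ℝ → ℝ) := by
  unfold reducedEnergy; fun_prop

lemma norm_snd_le_of_reducedEnergy_le {R : ℝ} (hR : 0 ≤ R) {b : ℝ × E × ℝ}
    (hb : reducedEnergy b ≤ R ^ 2) : ‖b.2‖ ≤ R := by
  unfold reducedEnergy at hb
  refine max_le ?_ ?_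
  · exact abs_le_of_sq_le_sq' (by nlinarith [sq_nonneg b.2.2]) hR |>.2
  · exact abs_le_of_sq_le_sq (by nlinarith [sq_nonneg ‖b.2.1‖]) hR

lemma norm_reducedField_sub_le {H : E → E} {K : NNReal} (hH : LipschitzWith K H) {R : ℝ}
    {b c : ℝ × E × ℝ} (hb : ‖b.2‖ ≤ R) (hc : ‖c.2‖ ≤ R) :
    ‖reducedField H b - reducedField H c‖ ≤ (1 + (‖H 0‖ + K * R) + K * R) * ‖b.2 - c.2‖ := by
  obtain ⟨u, ξ, η⟩ := b
  obtain ⟨u', ξ', η'⟩ := c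
  simp only [Prod.mk_sub_mk] at hb hc ⊢
  have hξ : ‖ξ‖ ≤ R := (le_max_left _ _).trans hb
  have hξ' : ‖ξ'‖ ≤ R := (le_max_left _ _).trans hc
  have hη' : ‖η'‖ ≤ R := (le_max_right _ _).trans hc
  have hR : 0 ≤ R := (norm_nonneg _).trans hξ
  set d := ‖(ξ - ξ', η - η')‖ with hd
  have hd0 : 0 ≤ d := norm_nonneg _
  have h1 : ‖ξ - ξ'‖ ≤ d := le_max_left _ _
  have h2 : ‖η - η'‖ ≤ d := le_max_right _ _
  have hM : ‖H ξ‖ ≤ ‖H 0‖ + K * R := by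
    have := hH.dist_le_mul ξ 0
    rw [dist_eq_norm, dist_zero_right] at this
    have h2 := norm_sub_norm_le (H ξ) (H 0)
    have h3 : (K : ℝ) * ‖ξ‖ ≤ K * R := by gcongr
    linarith
  have hL : ‖H ξ - H ξ'‖ ≤ K * d := by
    have := hH.dist_le_mul ξ ξ'
    rw [dist_eq_norm, dist_eq_norm] at this
    exact this.trans (by gcongr)
  have hK : 0 ≤ (K : ℝ) * R := by positivity
  have hM0 : 0 ≤ ‖H 0‖ + K * R := by positivity
  refine max_le ?_ (max_le ?_ ?_)
  · change ‖η - η'‖ ≤ _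
    nlinarith
  · have : η • H ξ - η' • H ξ' = (η - η') • H ξ + η' • (H ξ - H ξ') := by
      rw [sub_smul, smul_sub]; abel
    change ‖η • H ξ - η' • H ξ'‖ ≤ _
    rw [this]
    refine (norm_add_le _ _).trans ?_
    rw [norm_smul, norm_smul]
    have e1 : ‖η - η'‖ * ‖H ξ‖ ≤ d * (‖H 0‖ + K * R) := by gcongr
    have e2 : ‖η'‖ * ‖H ξ - H ξ'‖ ≤ R * (K * d) := by gcongr
    nlinarith
  · have : -inner ℝ (H ξ) ξ - -inner ℝ (H ξ') ξ' =
        -(inner ℝ (H ξ) (ξ - ξ') + inner ℝ (H ξ - H ξ') ξ') := by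
      rw [inner_sub_right, inner_sub_left]; ring
    change ‖-inner ℝ (H ξ) ξ - -inner ℝ (H ξ') ξ'‖ ≤ _
    rw [this, norm_neg]
    refine (norm_add_le _ _).trans ?_
    have e1 : ‖(inner ℝ (H ξ) (ξ - ξ') : ℝ)‖ ≤ (‖H 0‖ + K * R) * d :=
      (norm_inner_le_norm _ _).trans (by gcongr)
    have e2 : ‖(inner ℝ (H ξ - H ξ') ξ' : ℝ)‖ ≤ (K * d) * R :=
      (norm_inner_le_norm _ _).trans (by gcongr)
    nlinarith

lemma exists_lipschitzWith_truncatedField {H : E → E} {K : NNReal} (hH : LipschitzWith K H) {R : ℝ}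
    (hR : 0 < R) : ∃ C, LipschitzWith C (truncatedField H R) := by
  refine ⟨(1 + (‖H 0‖₊ + K * R.toNNReal) + K * R.toNNReal) * 2,
    LipschitzWith.of_dist_le_mul fun b c => ?_⟩
  have h1 := norm_reducedField_sub_le hH (b := (b.1, radialRetraction R b.2))
    (c := (c.1, radialRetraction R c.2)) (norm_radialRetraction_le hR _)
    (norm_radialRetraction_le hR _)
  have h2 := (lipschitzWith_radialRetraction hR).dist_le_mul b.2 c.2
  rw [dist_eq_norm] at h2
  rw [dist_eq_norm]
  refine h1.trans ?_
  push_cast [Real.coe_toNNReal R hR.le] at h2 ⊢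
  rw [mul_assoc]
  gcongr
  refine h2.trans ?_
  gcongr
  exact le_max_right _ _

lemma hasDerivAt_reducedEnergy {c : ℝ → ℝ × E × ℝ} {c' : ℝ × E × ℝ} {t : ℝ}
    (hc : HasDerivAt c c' t) :
    HasDerivAt (fun s => reducedEnergy (c s))
      (2 * inner ℝ (c t).2.1 c'.2.1 + 2 * (c t).2.2 * c'.2.2) t := by
  have h2 : HasDerivAt (fun s => (c s).2) c'.2 t := hc.snd
  have h3 : HasDerivAt (fun s => (c s).2.1) c'.2.1 t := h2.fst
  have h4 : HasDerivAt (fun s => (c s).2.2) c'.2.2 t := h2.snd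
  have := h3.norm_sq.add (h4.pow 2)
  exact this.congr_deriv (by simp)

lemma reducedEnergy_const_of_truncatedField {H : E → E} {R : ℝ} {c : ℝ → ℝ × E × ℝ}
    (hc : ∀ t, HasDerivAt c (truncatedField H R (c t)) t) (s t : ℝ) :
    reducedEnergy (c s) = reducedEnergy (c t) := by
  refine is_const_of_deriv_eq_zero (f := fun s => reducedEnergy (c s))
    (fun t => (hasDerivAt_reducedEnergy (hc t)).differentiableAt) (fun t => ?_) s t
  rw [(hasDerivAt_reducedEnergy (hc t)).deriv]
  simp only [truncatedField, reducedField, radialRetraction, Prod.smul_fst, Prod.smul_snd,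
    inner_smul_right, smul_eq_mul, real_inner_comm]
  ring

lemma reducedEnergy_const {H : E → E} {c : ℝ → ℝ × E × ℝ}
    (hc : ∀ t, HasDerivAt c (reducedField H (c t)) t) (s t : ℝ) :
    reducedEnergy (c s) = reducedEnergy (c t) := by
  refine is_const_of_deriv_eq_zero (f := fun s => reducedEnergy (c s))
    (fun t => (hasDerivAt_reducedEnergy (hc t)).differentiableAt) (fun t => ?_) s t
  rw [(hasDerivAt_reducedEnergy (hc t)).deriv]
  simp only [reducedField, inner_smul_right, real_inner_comm]
  ring

lemma truncatedField_eq {H : E → E} {R : ℝ} (hR : 0 < R) {b : ℝ × E × ℝ}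
    (hb : reducedEnergy b ≤ R ^ 2) : truncatedField H R b = reducedField H b := by
  rw [truncatedField, radialRetraction_of_norm_le hR (norm_snd_le_of_reducedEnergy_le hR.le hb)]

lemma reducedEnergy_nonneg (b : ℝ × E × ℝ) : 0 ≤ reducedEnergy b := by
  unfold reducedEnergy; positivity

lemma reducedEnergy_lt_sq (b : ℝ × E × ℝ) :
    reducedEnergy b < (Real.sqrt (reducedEnergy b) + 1) ^ 2 := by
  nlinarith [Real.sq_sqrt (reducedEnergy_nonneg b), Real.sqrt_nonneg (reducedEnergy b)]

lemma reduced_integralCurve_unique {H : E → E} {K : NNReal} (hH : LipschitzWith K H)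
    {c d : ℝ → ℝ × E × ℝ} (hc : ∀ t, HasDerivAt c (reducedField H (c t)) t)
    (hd : ∀ t, HasDerivAt d (reducedField H (d t)) t) {t₀ : ℝ} (h : c t₀ = d t₀) : c = d := by
  have hR : 0 < Real.sqrt (reducedEnergy (c t₀)) + 1 := by positivity
  obtain ⟨C, hC⟩ := exists_lipschitzWith_truncatedField hH hR
  refine integralCurve_unique hC (fun t => ?_) (fun t => ?_) h
  · rw [truncatedField_eq hR]
    · exact hc t
    · rw [reducedEnergy_const hc t t₀]; exact (reducedEnergy_lt_sq _).le
  · rw [truncatedField_eq hR]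
    · exact hd t
    · rw [reducedEnergy_const hd t t₀, ← h]; exact (reducedEnergy_lt_sq _).le

/-- The reduced system is complete: on each energy sublevel set it is a globally Lipschitz system. -/
lemma exists_reducedFlow [CompleteSpace E] {H : E → E} {K : NNReal} (hH : LipschitzWith K H) :
    ∃ φ : Flow ℝ (ℝ × E × ℝ),
      ∀ b t, HasDerivAt (fun s => φ s b) (reducedField H (φ t b)) t := by
  have hT : ∀ R : ℝ, ∃ φ : Flow ℝ (ℝ × E × ℝ), 0 < R →
      ∀ b t, HasDerivAt (fun s => φ s b) (truncatedField H R (φ t b)) t := by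
    intro R
    by_cases hR : 0 < R
    · obtain ⟨C, hC⟩ := exists_lipschitzWith_truncatedField hH hR
      obtain ⟨φ, hφ, -⟩ := exists_flow_of_lipschitz hC
      exact ⟨φ, fun _ => hφ⟩
    · exact ⟨Flow.id _ _, fun h => absurd h hR⟩
  choose Φ hΦ using hT
  have hsol : ∀ R > 0, ∀ b, reducedEnergy b ≤ R ^ 2 →
      ∀ t, HasDerivAt (fun s => Φ R s b) (reducedField H (Φ R t b)) t := by
    intro R hR b hb t
    rw [← truncatedField_eq hR]
    · exact hΦ R hR b t
    · rw [reducedEnergy_const_of_truncatedField (hΦ R hR b) t 0, Flow.map_zero_apply]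
      exact hb
  set ρ : ℝ × E × ℝ → ℝ := fun b => Real.sqrt (reducedEnergy b) + 1 with hρ
  have hρ0 : ∀ b, 0 < ρ b := fun b => by positivity
  have hagree : ∀ R > 0, ∀ b, reducedEnergy b ≤ R ^ 2 → ∀ t, Φ (ρ b) t b = Φ R t b := by
    intro R hR b hb t
    refine congrFun (reduced_integralCurve_unique hH (t₀ := 0)
      (hsol _ (hρ0 b) b (reducedEnergy_lt_sq b).le) (hsol R hR b hb) ?_) t
    rw [Flow.map_zero_apply, Flow.map_zero_apply]
  have hder : ∀ b t, HasDerivAt (fun s => Φ (ρ b) s b) (reducedField H (Φ (ρ b) t b)) t :=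
    fun b => hsol _ (hρ0 b) b (reducedEnergy_lt_sq b).le
  refine ⟨⟨fun t b => Φ (ρ b) t b, ?_, ?_, fun b => Flow.map_zero_apply _ _⟩, hder⟩
  · refine continuous_iff_continuousAt.2 fun ⟨t, b⟩ => ?_
    have h1 : ContinuousAt (fun p : ℝ × ℝ × E × ℝ => Φ (ρ b) p.1 p.2) (t, b) := by fun_prop
    refine h1.congr ?_
    have h2 : ∀ᶠ p : ℝ × ℝ × E × ℝ in 𝓝 (t, b), reducedEnergy p.2 < ρ b ^ 2 :=
      (continuous_reducedEnergy.comp continuous_snd).continuousAt.eventually_lt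
        continuousAt_const (reducedEnergy_lt_sq b)
    filter_upwards [h2] with p hp
    exact (hagree (ρ b) (hρ0 b) p.2 hp.le p.1).symm
  · intro s t b
    have : (fun s => Φ (ρ b) (s + t) b) = fun s => Φ (ρ (Φ (ρ b) t b)) s (Φ (ρ b) t b) := by
      refine reduced_integralCurve_unique hH (t₀ := 0)
        (fun s => (hder b (s + t)).comp_add_const s t) (hder _) ?_
      rw [Flow.map_zero_apply, zero_add]
    exact congrFun this s

end ReducedFlow

/-! ### Turning points and periodic orbits -/

/-- A solution of a Newton equation that is trapped in a compact interval which contains no critical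
point of the potential on the given energy level turns around at arbitrarily late times: otherwise
it would converge monotonically, and the limit would be such a critical point. -/
lemma exists_turning_point {s η v g : ℝ → ℝ} {h α β : ℝ} (hs : ∀ t, HasDerivAt s (η t) t)
    (hη : ∀ t, HasDerivAt η (-g (s t)) t) (hen : ∀ t, η t ^ 2 + v (s t) = h) (hv : Continuous v)
    (hg : Continuous g) (hmem : ∀ t, s t ∈ Icc α β) (hreg : ∀ x ∈ Icc α β, v x = h → g x ≠ 0)
    (t₀ : ℝ) : ∃ t > t₀, η t = 0 := by
  by_contra! hne
  obtain ⟨S, hS⟩ : ∃ S, Filter.Tendsto s Filter.atTop (𝓝 S) := by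
    have hscont : Continuous s := continuous_iff_continuousAt.2 fun t => (hs t).continuousAt
    have hev : (fun t => s (max t t₀)) =ᶠ[Filter.atTop] s := by
      filter_upwards [Filter.eventually_ge_atTop t₀] with t ht
      rw [max_eq_left ht]
    rcases hasDerivWithinAt_forall_lt_or_forall_gt_of_forall_ne (convex_Ioi t₀)
      (fun x _ => (hs x).hasDerivWithinAt) (m := 0) (fun x hx => hne x hx) with hlt | hgt
    · have hanti : AntitoneOn s (Ici t₀) := antitoneOn_of_deriv_nonpos (convex_Ici t₀)
        hscont.continuousOn (fun x _ => (hs x).differentiableAt.differentiableWithinAt)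
        (fun x hx => by
          rw [interior_Ici] at hx
          rw [(hs x).deriv]; exact (hlt x hx).le)
      have : Antitone fun t => s (max t t₀) := fun a b hab =>
        hanti (mem_Ici.2 (le_max_right _ _)) (mem_Ici.2 (le_max_right _ _))
          (max_le_max_right _ hab)
      exact ⟨_, (tendsto_atTop_ciInf this ⟨α, by rintro _ ⟨t, rfl⟩; exact (hmem _).1⟩).congr' hev⟩
    · have hmono : MonotoneOn s (Ici t₀) := monotoneOn_of_deriv_nonneg (convex_Ici t₀)
        hscont.continuousOn (fun x _ => (hs x).differentiableAt.differentiableWithinAt)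
        (fun x hx => by
          rw [interior_Ici] at hx
          rw [(hs x).deriv]; exact (hgt x hx).le)
      have : Monotone fun t => s (max t t₀) := fun a b hab =>
        hmono (mem_Ici.2 (le_max_right _ _)) (mem_Ici.2 (le_max_right _ _))
          (max_le_max_right _ hab)
      exact ⟨_, (tendsto_atTop_ciSup this ⟨β, by rintro _ ⟨t, rfl⟩; exact (hmem _).2⟩).congr' hev⟩
  have hSmem : S ∈ Icc α β := isClosed_Icc.mem_of_tendsto hS (Filter.Eventually.of_forall hmem)
  -- By the mean value theorem, a convergent function takes small derivatives at late times.
  have hmvt : ∀ f f' : ℝ → ℝ, (∀ t, HasDerivAt f (f' t) t) → ∀ l m,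
      Filter.Tendsto f Filter.atTop (𝓝 l) → Filter.Tendsto f' Filter.atTop (𝓝 m) → m = 0 := by
    intro f f' hf l m hl hm
    have hex : ∀ t : ℝ, ∃ c ∈ Ioo t (t + 1), f' c = f (t + 1) - f t := fun t => by
      obtain ⟨c, hc, hc'⟩ := exists_hasDerivAt_eq_slope f f' (lt_add_one t)
        (continuous_iff_continuousAt.2 fun t => (hf t).continuousAt).continuousOn
        (fun x _ => hf x)
      exact ⟨c, hc, by rw [hc']; simp⟩
    choose c hc hfc using hex
    have h1 : Filter.Tendsto c Filter.atTop Filter.atTop :=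
      Filter.tendsto_atTop_mono (fun t => (hc t).1.le) Filter.tendsto_id
    have h2 : Filter.Tendsto (fun t => f (t + 1) - f t) Filter.atTop (𝓝 (l - l)) :=
      (hl.comp (Filter.tendsto_atTop_add_const_right _ 1 Filter.tendsto_id)).sub hl
    have h3 : Filter.Tendsto (fun t => f' (c t)) Filter.atTop (𝓝 m) := hm.comp h1
    simp only [hfc] at h3
    rw [sub_self] at h2
    exact tendsto_nhds_unique h3 h2
  have hη2 : Filter.Tendsto (fun t => η t ^ 2) Filter.atTop (𝓝 (h - v S)) := by
    have : (fun t => η t ^ 2) = fun t => h - v (s t) := funext fun t => by linarith [hen t]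
    rw [this]
    exact tendsto_const_nhds.sub ((hv.tendsto S).comp hS)
  have habs : Filter.Tendsto (fun t => |η t|) Filter.atTop (𝓝 (Real.sqrt (h - v S))) := by
    simpa [Real.sqrt_sq_eq_abs] using hη2.sqrt
  -- The velocity has constant sign, so it converges as well.
  obtain ⟨m, hm⟩ : ∃ m, Filter.Tendsto η Filter.atTop (𝓝 m) := by
    rcases hasDerivWithinAt_forall_lt_or_forall_gt_of_forall_ne (convex_Ioi t₀)
      (fun x _ => (hs x).hasDerivWithinAt) (m := 0) (fun x hx => hne x hx) with hlt | hgt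
    · refine ⟨-Real.sqrt (h - v S), habs.neg.congr' ?_⟩
      filter_upwards [Filter.eventually_gt_atTop t₀] with t ht
      rw [abs_of_neg (hlt t ht), neg_neg]
    · refine ⟨Real.sqrt (h - v S), habs.congr' ?_⟩
      filter_upwards [Filter.eventually_gt_atTop t₀] with t ht
      rw [abs_of_pos (hgt t ht)]
  have hm0 : m = 0 := hmvt s η hs S m hS hm
  have hg0 : -g S = 0 := hmvt η _ hη m _ hm (((hg.tendsto S).comp hS).neg)
  have hvS : h - v S = 0 := tendsto_nhds_unique hη2 (by simpa [hm0] using hm.pow 2)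
  exact hreg S hSmem (by linarith) (by linarith)

section Orbits

variable {E : Type*} [NormedAddCommGroup E] [InnerProductSpace ℝ E]

/-- `φ` is the flow of the vector field `X`. -/
def IsFlowOf {V : Type*} [NormedAddCommGroup V] [NormedSpace ℝ V] (X : V → V) (φ : Flow ℝ V) :
    Prop :=
  ∀ x t, HasDerivAt (fun s => φ s x) (X (φ t x)) t

/-- The orbit of `ξ` under the flow `Φ` of `H` leaves the ball of radius `√h`, where `h` is the
energy of `b = (u, ξ, η)`, both in forward and in backward time, and until it has done so it is
nowhere tangent to the sphere of radius `√h`. This makes the orbit of `b` under the reduced system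
periodic. -/
def IsConfined (H : E → E) (Φ : Flow ℝ E) (b : ℝ × E × ℝ) : Prop :=
  ∃ α β : ℝ, α < 0 ∧ 0 < β ∧ reducedEnergy b < ‖Φ α b.2.1‖ ^ 2 ∧
    reducedEnergy b < ‖Φ β b.2.1‖ ^ 2 ∧
    ∀ s ∈ Icc α β, ‖Φ s b.2.1‖ ^ 2 = reducedEnergy b → inner ℝ (H (Φ s b.2.1)) (Φ s b.2.1) ≠ 0

variable {H : E → E} {K : NNReal} {Φ : Flow ℝ E} {φ : Flow ℝ (ℝ × E × ℝ)}

lemma hasDerivAt_fst_reducedFlow (hφ : IsFlowOf (reducedField H) φ) (b : ℝ × E × ℝ) (t : ℝ) :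
    HasDerivAt (fun s => (φ s b).1) (φ t b).2.2 t :=
  (hφ b t).fst

lemma hasDerivAt_snd_snd_reducedFlow (hφ : IsFlowOf (reducedField H) φ) (b : ℝ × E × ℝ) (t : ℝ) :
    HasDerivAt (fun s => (φ s b).2.2) (-inner ℝ (H (φ t b).2.1) (φ t b).2.1) t :=
  (hφ b t).snd.snd

lemma reducedEnergy_flow (hφ : IsFlowOf (reducedField H) φ) (b : ℝ × E × ℝ) (t : ℝ) :
    reducedEnergy (φ t b) = reducedEnergy b := by
  have := reducedEnergy_const (hφ b) t 0
  rwa [Flow.map_zero_apply] at this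

/-- The component `ξ` of the reduced system moves along an orbit of `H`, with time parameter `u`. -/
lemma reducedFlow_fst_snd (hH : LipschitzWith K H) (hΦ : IsFlowOf H Φ)
    (hφ : IsFlowOf (reducedField H) φ) (b : ℝ × E × ℝ) (t : ℝ) :
    (φ t b).2.1 = Φ ((φ t b).1 - b.1) b.2.1 := by
  set R : NNReal := (Real.sqrt (reducedEnergy b)).toNNReal
  have hR : ∀ t, ‖(φ t b).2.2‖ ≤ R := fun t => by
    rw [Real.coe_toNNReal _ (Real.sqrt_nonneg _)]
    refine (le_max_right _ _).trans (norm_snd_le_of_reducedEnergy_le (Real.sqrt_nonneg _) ?_)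
    rw [Real.sq_sqrt (reducedEnergy_nonneg b), reducedEnergy_flow hφ]
  have := ODE_solution_unique_univ (v := fun t x => (φ t b).2.2 • H x) (s := fun _ => univ)
    (K := R * K) (t₀ := 0) (f := fun t => (φ t b).2.1) (g := fun t => Φ ((φ t b).1 - b.1) b.2.1)
    (fun t => LipschitzWith.lipschitzOnWith (LipschitzWith.of_dist_le_mul fun x y => by
      rw [dist_eq_norm, ← smul_sub, norm_smul, NNReal.coe_mul, mul_assoc, ← dist_eq_norm]
      exact mul_le_mul (hR t) (hH.dist_le_mul x y) dist_nonneg R.coe_nonneg))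
    (fun t => ⟨(hφ b t).snd.fst, trivial⟩)
    (fun t => ⟨(hΦ b.2.1 _).scomp t ((hasDerivAt_fst_reducedFlow hφ b t).sub_const _), trivial⟩)
    (by simp)
  exact congrFun this t

lemma hasDerivAt_norm_sq_flow (hΦ : IsFlowOf H Φ) (x : E) (t : ℝ) :
    HasDerivAt (fun s => ‖Φ s x‖ ^ 2) (2 * inner ℝ (H (Φ t x)) (Φ t x)) t := by
  have := (hΦ x t).norm_sq
  rwa [real_inner_comm] at this

lemma energy_identity (hH : LipschitzWith K H) (hΦ : IsFlowOf H Φ)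
    (hφ : IsFlowOf (reducedField H) φ) (b : ℝ × E × ℝ) (t : ℝ) :
    (φ t b).2.2 ^ 2 + ‖Φ ((φ t b).1 - b.1) b.2.1‖ ^ 2 = reducedEnergy b := by
  rw [← reducedFlow_fst_snd hH hΦ hφ, ← reducedEnergy_flow hφ b t, reducedEnergy, add_comm]

lemma displacement_mem_Ioo (hH : LipschitzWith K H) (hΦ : IsFlowOf H Φ)
    (hφ : IsFlowOf (reducedField H) φ) {b : ℝ × E × ℝ} {α β : ℝ} (hα : α < 0) (hβ : 0 < β)
    (hvα : reducedEnergy b < ‖Φ α b.2.1‖ ^ 2) (hvβ : reducedEnergy b < ‖Φ β b.2.1‖ ^ 2) (t : ℝ) :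
    (φ t b).1 - b.1 ∈ Ioo α β := by
  have hcont : Continuous fun t => (φ t b).1 - b.1 := by fun_prop
  have h0 : (φ 0 b).1 - b.1 = 0 := by simp
  refine ⟨?_, ?_⟩
  · by_contra! h
    obtain ⟨t', ht'⟩ := mem_range_of_exists_le_of_exists_ge hcont ⟨t, h⟩ ⟨0, by rw [h0]; exact hα.le⟩
    have := energy_identity hH hΦ hφ b t'
    rw [show (φ t' b).1 - b.1 = _ from ht'] at this
    nlinarith [sq_nonneg (φ t' b).2.2]
  · by_contra! h
    obtain ⟨t', ht'⟩ := mem_range_of_exists_le_of_exists_ge hcont ⟨0, by rw [h0]; exact hβ.le⟩ ⟨t, h⟩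
    have := energy_identity hH hΦ hφ b t'
    rw [show (φ t' b).1 - b.1 = _ from ht'] at this
    nlinarith [sq_nonneg (φ t' b).2.2]

lemma continuous_inner_flow (hH : LipschitzWith K H) (x : E) :
    Continuous fun s => inner ℝ (H (Φ s x)) (Φ s x) := by
  have : Continuous fun s => Φ s x := by fun_prop
  exact (hH.continuous.comp this).inner this

lemma IsConfined.exists_turning_point (hH : LipschitzWith K H) (hΦ : IsFlowOf H Φ)
    (hφ : IsFlowOf (reducedField H) φ) {b : ℝ × E × ℝ} (hb : IsConfined H Φ b) (t₀ : ℝ) :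
    ∃ t > t₀, (φ t b).2.2 = 0 := by
  obtain ⟨α, β, hα, hβ, hvα, hvβ, hreg⟩ := hb
  have hΦc : Continuous fun s => Φ s b.2.1 := by fun_prop
  refine LF.exists_turning_point (s := fun t => (φ t b).1 - b.1) (η := fun t => (φ t b).2.2)
    (v := fun s => ‖Φ s b.2.1‖ ^ 2) (g := fun s => inner ℝ (H (Φ s b.2.1)) (Φ s b.2.1))
    (h := reducedEnergy b) (fun t => (hasDerivAt_fst_reducedFlow hφ b t).sub_const _)
    (fun t => ?_) (energy_identity hH hΦ hφ b) (by fun_prop) (continuous_inner_flow hH _)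
    (fun t => Ioo_subset_Icc_self (displacement_mem_Ioo hH hΦ hφ hα hβ hvα hvβ t)) hreg t₀
  have := hasDerivAt_snd_snd_reducedFlow hφ b t
  rwa [reducedFlow_fst_snd hH hΦ hφ b t] at this

/-- The reduced system is reversible: an orbit is symmetric about each of its turning points. -/
lemma reducedFlow_reflect (hH : LipschitzWith K H) (hφ : IsFlowOf (reducedField H) φ)
    {b : ℝ × E × ℝ} {t₁ : ℝ} (h : (φ t₁ b).2.2 = 0) (t : ℝ) :
    φ (2 * t₁ - t) b = ((φ t b).1, (φ t b).2.1, -(φ t b).2.2) := by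
  have hd : ∀ t, HasDerivAt (fun t => ((φ (2 * t₁ - t) b).1, (φ (2 * t₁ - t) b).2.1,
      -(φ (2 * t₁ - t) b).2.2)) (reducedField H ((φ (2 * t₁ - t) b).1, (φ (2 * t₁ - t) b).2.1,
      -(φ (2 * t₁ - t) b).2.2)) t := by
    intro t
    have h0 := (hφ b (2 * t₁ - t)).comp_const_sub (2 * t₁) t
    have h1 : HasDerivAt (fun t => (φ (2 * t₁ - t) b).1) _ t := h0.fst
    have h2 : HasDerivAt (fun t => (φ (2 * t₁ - t) b).2.1) _ t := h0.snd.fst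
    have h3 : HasDerivAt (fun t => (φ (2 * t₁ - t) b).2.2) _ t := h0.snd.snd
    refine (h1.prodMk (h2.prodMk h3.neg)).congr_deriv ?_
    simp [reducedField]
  have := reduced_integralCurve_unique hH (t₀ := t₁) hd (hφ b) (by
    have e : 2 * t₁ - t₁ = t₁ := by ring
    simp only [e, h, neg_zero]
    rw [← h])
  rw [← congrFun this t, neg_neg]

/-- The orbits of confined points are periodic, with a smallest period. -/
lemma IsConfined.exists_period (hH : LipschitzWith K H) (hΦ : IsFlowOf H Φ)
    (hφ : IsFlowOf (reducedField H) φ) {b : ℝ × E × ℝ} (hb : IsConfined H Φ b) :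
    ∃ T > 0, ∀ s t, φ s b = φ t b ↔ ∃ k : ℤ, s - t = k * T := by
  let S : AddSubgroup ℝ :=
    { carrier := {t | φ t b = b}
      zero_mem' := Flow.map_zero_apply _ _
      add_mem' := fun {s t} hs ht => by
        change φ (s + t) b = b
        rw [Flow.map_add, show φ t b = b from ht, show φ s b = b from hs]
      neg_mem' := fun {t} ht => by
        change φ (-t) b = b
        conv_lhs => rw [← show φ t b = b from ht]
        rw [← Flow.map_add, neg_add_cancel, Flow.map_zero_apply] }
  have hSmem : ∀ t, t ∈ S ↔ φ t b = b := fun t => Iff.rfl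
  have hst : ∀ s t, φ s b = φ t b ↔ s - t ∈ S := fun s t => by
    rw [hSmem]
    constructor
    · intro h
      rw [sub_eq_neg_add, Flow.map_add, h, ← Flow.map_add, neg_add_cancel, Flow.map_zero_apply]
    · intro h
      conv_rhs => rw [← h]
      rw [← Flow.map_add, add_sub_cancel]
  have hclosed : IsClosed (S : Set ℝ) := by
    have : Continuous fun t => φ t b := by fun_prop
    exact isClosed_eq this continuous_const
  obtain ⟨t₀, -, h0⟩ := hb.exists_turning_point hH hΦ hφ 0
  obtain ⟨t₁, h01, h1⟩ := hb.exists_turning_point hH hΦ hφ t₀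
  have hmem : 2 * (t₁ - t₀) ∈ S := by
    have e1 := reducedFlow_reflect hH hφ h0 0
    have e2 := reducedFlow_reflect hH hφ h1 (2 * t₀ - 0)
    rw [e1] at e2
    have e3 : 2 * t₁ - (2 * t₀ - 0) = 2 * (t₁ - t₀) := by ring
    rw [e3] at e2
    rw [hSmem, e2]
    simp
  rcases AddSubgroup.dense_or_cyclic S with hd | ⟨a, ha⟩
  · exfalso
    have huniv : (S : Set ℝ) = univ := by rw [← hclosed.closure_eq]; exact hd.closure_eq
    have hfix : (fun t => φ t b) = fun _ => b := funext fun t => by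
      have : t ∈ (S : Set ℝ) := huniv ▸ mem_univ t
      exact this
    have hder := hφ b 0
    rw [hfix, Flow.map_zero_apply] at hder
    have hzero : reducedField H b = 0 := hder.unique (hasDerivAt_const 0 b)
    obtain ⟨α, β, hα, hβ, -, -, hreg⟩ := hb
    refine hreg 0 ⟨hα.le, hβ.le⟩ ?_ ?_
    · have : b.2.2 = 0 := congrArg Prod.fst hzero
      simp [reducedEnergy, this]
    · have : -inner ℝ (H b.2.1) b.2.1 = 0 := congrArg (fun x => x.2.2) hzero
      simpa using this
  · have ha0 : a ≠ 0 := by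
      rintro rfl
      rw [ha] at hmem
      simp only [AddSubgroup.closure_singleton_zero, AddSubgroup.mem_bot] at hmem
      linarith
    refine ⟨|a|, abs_pos.2 ha0, fun s t => ?_⟩
    rw [hst, ha, AddSubgroup.mem_closure_singleton]
    rcases abs_choice a with h | h <;> rw [h]
    · simp only [zsmul_eq_mul, eq_comm]
    · constructor
      · rintro ⟨k, hk⟩; exact ⟨-k, by rw [← hk]; simp⟩
      · rintro ⟨k, hk⟩; exact ⟨-k, by rw [hk]; simp⟩

end Orbits

/-! ### The flow on `TM` -/

section

section Smooth

variable {V : Type*} [NormedAddCommGroup V] [NormedSpace ℝ V]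

lemma contDiff_succ_of_hasDerivAt {n : ℕ} {f f' : ℝ → V} (hf : ∀ t, HasDerivAt f (f' t) t)
    (hf' : ContDiff ℝ n f') : ContDiff ℝ (n + 1) f :=
  contDiff_succ_iff_deriv.2 ⟨fun t => (hf t).differentiableAt, fun h => by simp at h, by
    rwa [show deriv f = f' from funext fun t => (hf t).deriv]⟩

lemma contDiff_of_hasDerivAt {r : ℕ∞} {f f' : ℝ → V} (hf : ∀ t, HasDerivAt f (f' t) t)
    (hf' : ContDiff ℝ r f') : ContDiff ℝ r f := by
  rw [contDiff_iff_forall_nat_le]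
  intro m hm
  exact (contDiff_succ_of_hasDerivAt hf (hf'.of_le (by exact_mod_cast hm))).of_le (by simp)

lemma contDiff_exp_smul_apply [CompleteSpace V] (L : V →L[ℝ] V) {n : WithTop ℕ∞}
    {W : Type*} [NormedAddCommGroup W] [NormedSpace ℝ W] {f : W → ℝ} {g : W → V}
    (hf : ContDiff ℝ n f) (hg : ContDiff ℝ n g) :
    ContDiff ℝ n fun x => NormedSpace.exp (f x • L) (g x) := by
  have h1 : ContDiff ℝ n (NormedSpace.exp : (V →L[ℝ] V) → (V →L[ℝ] V)) :=
    contDiff_iff_contDiffAt.2 fun x => (NormedSpace.exp_analytic (𝕂 := ℝ) x).contDiffAt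
  exact (h1.comp (hf.smul contDiff_const)).clm_apply hg

end Smooth

variable {E : Type*} [NormedAddCommGroup E] [InnerProductSpace ℝ E]
variable {H : E → E} {K : NNReal} {Φ : Flow ℝ E} {φ : Flow ℝ (ℝ × E × ℝ)}

/-- An orbit of the reduced system that stays in a set where the vector field is of class `C^r` is
itself of class `C^r`. -/
lemma contDiff_reducedFlow {r : ℕ∞} (hφ : IsFlowOf (reducedField H) φ) {H' : E → E} {D : Set E}
    (hD : ContDiffOn ℝ r H' D) (hHD : EqOn H H' D) {b : ℝ × E × ℝ}
    (hb : ∀ t, (φ t b).2.1 ∈ D) : ContDiff ℝ r fun t => φ t b := by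
  rw [contDiff_iff_forall_nat_le]
  intro m
  induction m with
  | zero =>
    intro _
    exact contDiff_zero.2 (by fun_prop)
  | succ n ih =>
    intro hn
    have hn' : (n : ℕ∞) ≤ r := le_trans (by exact_mod_cast n.le_succ) hn
    have hc := ih hn'
    have hξ : ContDiff ℝ n fun t => (φ t b).2.1 := hc.snd.fst
    have hη : ContDiff ℝ n fun t => (φ t b).2.2 := hc.snd.snd
    have hH : ContDiff ℝ n fun t => H (φ t b).2.1 := by
      have : (fun t => H (φ t b).2.1) = fun t => H' (φ t b).2.1 := funext fun t => hHD (hb t)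
      rw [this]
      exact (hD.of_le (by exact_mod_cast hn')).comp_contDiff hξ hb
    exact_mod_cast contDiff_succ_of_hasDerivAt (hφ b) (hη.prodMk ((hη.smul hH).prodMk
      (hH.inner ℝ hξ).neg))

variable [FiniteDimensional ℝ E]

/-- The displacement of the component `w` along an orbit of the reduced system. -/
def displacement (L : E →L[ℝ] E) (φ : Flow ℝ (ℝ × E × ℝ)) (t : ℝ) (b : ℝ × E × ℝ) : E :=
  ∫ s in 0..t, NormedSpace.exp ((φ s b).1 • L) (φ s b).2.1

lemma continuous_exp_smul_apply (L : E →L[ℝ] E) :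
    Continuous fun b : ℝ × E × ℝ => NormedSpace.exp (b.1 • L) b.2.1 :=
  (contDiff_exp_smul_apply L (n := 0) contDiff_fst contDiff_snd.fst).continuous

lemma continuous_displacement (L : E →L[ℝ] E) (φ : Flow ℝ (ℝ × E × ℝ)) :
    Continuous fun p : ℝ × ℝ × E × ℝ => displacement L φ p.1 p.2 := by
  have h : Continuous (Function.uncurry fun (b : ℝ × E × ℝ) (s : ℝ) =>
      NormedSpace.exp ((φ s b).1 • L) (φ s b).2.1) :=
    (continuous_exp_smul_apply L).comp (by fun_prop : Continuous fun p : (ℝ × E × ℝ) × ℝ => φ p.2 p.1)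
  have := intervalIntegral.continuous_parametric_primitive_of_continuous
    (μ := MeasureTheory.volume) (a₀ := 0) h
  exact this.comp continuous_swap

lemma hasDerivAt_displacement (L : E →L[ℝ] E) (φ : Flow ℝ (ℝ × E × ℝ)) (b : ℝ × E × ℝ) (t : ℝ) :
    HasDerivAt (fun s => displacement L φ s b)
      (NormedSpace.exp ((φ t b).1 • L) (φ t b).2.1) t := by
  have h : Continuous fun s => NormedSpace.exp ((φ s b).1 • L) (φ s b).2.1 :=
    (continuous_exp_smul_apply L).comp (by fun_prop)
  exact intervalIntegral.integral_hasDerivAt_right (h.intervalIntegrable _ _)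
    (h.stronglyMeasurableAtFilter _ _) h.continuousAt

lemma displacement_zero (L : E →L[ℝ] E) (φ : Flow ℝ (ℝ × E × ℝ)) (b : ℝ × E × ℝ) :
    displacement L φ 0 b = 0 := by
  simp [displacement]

lemma displacement_add (L : E →L[ℝ] E) (φ : Flow ℝ (ℝ × E × ℝ)) (s t : ℝ) (b : ℝ × E × ℝ) :
    displacement L φ (s + t) b = displacement L φ t b + displacement L φ s (φ t b) := by
  have h : Continuous fun s => NormedSpace.exp ((φ s b).1 • L) (φ s b).2.1 :=
    (continuous_exp_smul_apply L).comp (by fun_prop)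
  have e : displacement L φ s (φ t b) =
      ∫ x in t..(s + t), NormedSpace.exp ((φ x b).1 • L) (φ x b).2.1 := by
    have := intervalIntegral.integral_comp_add_right (a := 0) (b := s)
      (fun x => NormedSpace.exp ((φ x b).1 • L) (φ x b).2.1) t
    rw [zero_add] at this
    rw [← this]
    simp only [displacement, Flow.map_add]
  rw [e, displacement, displacement]
  exact (intervalIntegral.integral_add_adjacent_intervals (h.intervalIntegrable _ _)
    (h.intervalIntegrable _ _)).symm

variable (Γ : Submodule ℤ E)

/-- The flow of the `L`-`H` system on `TM`, as a skew product over the reduced flow. -/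
def skewFlow (L : E →L[ℝ] E) (φ : Flow ℝ (ℝ × E × ℝ)) : Flow ℝ (TM Γ) where
  toFun t p := (p.1 + Submodule.Quotient.mk (displacement L φ t p.2), φ t p.2)
  cont' := by
    have h1 : Continuous fun x : E => (Submodule.Quotient.mk x : E ⧸ Γ) := continuous_quot_mk
    have h2 : Continuous fun q : ℝ × TM Γ => displacement L φ q.1 q.2.2 :=
      (continuous_displacement L φ).comp (continuous_fst.prodMk continuous_snd.snd)
    have h3 : Continuous fun q : ℝ × TM Γ => φ q.1 q.2.2 := by fun_prop
    exact ((continuous_snd.fst).add (h1.comp h2)).prodMk h3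
  map_add' s t p := by
    refine Prod.ext ?_ (Flow.map_add _ _ _ _)
    simp only [displacement_add, Submodule.Quotient.mk_add, add_assoc]
  map_zero' p := by
    refine Prod.ext ?_ (Flow.map_zero_apply _ _)
    simp only [displacement_zero, Submodule.Quotient.mk_zero, add_zero]

lemma skewFlow_apply (L : E →L[ℝ] E) (φ : Flow ℝ (ℝ × E × ℝ)) (t : ℝ) (p : TM Γ) :
    skewFlow Γ L φ t p = (p.1 + Submodule.Quotient.mk (displacement L φ t p.2), φ t p.2) := rfl

lemma isInvariant_skewFlow (hφ : IsFlowOf (reducedField H) φ) (L : E →L[ℝ] E) {P : Set (TM Γ)}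
    (hP : ∀ p q : TM Γ, energy Γ p = energy Γ q → p ∈ P → q ∈ P) :
    IsInvariant (skewFlow Γ L φ) P := fun t p hp =>
  hP p _ (reducedEnergy_flow hφ p.2 t).symm hp

lemma isLFFlow_skewFlow (hφ : IsFlowOf (reducedField H) φ) (L : E →L[ℝ] E) {P : Set (TM Γ)}
    (hP : ∀ p q : TM Γ, energy Γ p = energy Γ q → p ∈ P → q ∈ P) {H' : E → E}
    (hH' : ∀ p ∈ P, H p.2.2.1 = H' p.2.2.1) :
    IsLFFlow Γ L H' P ((skewFlow Γ L φ).restrict (isInvariant_skewFlow Γ hφ L hP)) := by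
  intro p hp
  have hproj : ∀ t, ((skewFlow Γ L φ).restrict (isInvariant_skewFlow Γ hφ L hP) t ⟨proj Γ p, hp⟩ :
      TM Γ) = proj Γ (p.1 + displacement L φ t p.2, φ t p.2) := fun t => by
    rw [Flow.coe_restrict_apply, skewFlow_apply]
    exact Prod.ext (Submodule.Quotient.mk_add Γ).symm rfl
  refine ⟨fun t => (p.1 + displacement L φ t p.2, φ t p.2), ?_, fun t => ?_, hproj⟩
  · simp only [displacement_zero, add_zero, Flow.map_zero_apply]
  · have h1 := ((hasDerivAt_displacement L φ p.2 t).const_add p.1).prodMk (hφ p.2 t)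
    have h2 : H (φ t p.2).2.1 = H' (φ t p.2).2.1 :=
      hH' (proj Γ (p.1 + displacement L φ t p.2, φ t p.2)) (by rw [← hproj]; exact Subtype.coe_prop _)
    refine h1.congr_deriv ?_
    simp only [field, reducedField, h2]

end

/-! ### Invariant tori -/

section Lattice

variable {E : Type*} [NormedAddCommGroup E] [InnerProductSpace ℝ E] [FiniteDimensional ℝ E]

/-- A basis of `E` that generates the lattice `Γ`. -/
lemma exists_basis_of_isZLattice (Γ : Submodule ℤ E) [DiscreteTopology Γ] [IsZLattice ℝ Γ] :
    ∃ e : Module.Basis (Fin (Module.finrank ℝ E)) ℝ E,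
      ∀ x : E, x ∈ Γ ↔ ∀ i, ∃ k : ℤ, e.repr x i = k := by
  have : Module.Finite ℤ Γ := ZLattice.module_finite ℝ Γ
  have : Module.Free ℤ Γ := ZLattice.module_free ℝ Γ
  let e₀ := Module.finBasisOfFinrankEq ℤ Γ (ZLattice.rank ℝ Γ)
  refine ⟨e₀.ofZLatticeBasis ℝ Γ, fun x => ?_⟩
  have h := (e₀.ofZLatticeBasis ℝ Γ).mem_span_iff_repr_mem ℤ x
  rw [Module.Basis.ofZLatticeBasis_span ℝ Γ e₀] at h
  rw [h]
  refine forall_congr' fun i => ?_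
  simp only [mem_range, algebraMap_int_eq, Int.coe_castRingHom, eq_comm]

lemma t2Space_quotient (Γ : Submodule ℤ E) [DiscreteTopology Γ] : T2Space (E ⧸ Γ) := by
  have : DiscreteTopology Γ.toAddSubgroup := ‹DiscreteTopology Γ›
  have : IsClosed (Γ : Set E) := AddSubgroup.isClosed_of_discrete (H := Γ.toAddSubgroup)
  have := Submodule.t3_quotient_of_isClosed Γ
  infer_instance

lemma unitAddCircle_coe_eq_iff {x y : ℝ} :
    (x : UnitAddCircle) = y ↔ ∃ k : ℤ, x - y = k := by
  rw [QuotientAddGroup.eq_iff_sub_mem, AddSubgroup.mem_zmultiples_iff]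
  simp only [zsmul_eq_mul, mul_one, eq_comm]

/-- The universal covering `ℝ^m → 𝕋^m`. -/
lemma isOpenQuotientMap_coe_pi (m : ℕ) :
    IsOpenQuotientMap fun (x : Fin m → ℝ) i => (x i : UnitAddCircle) :=
  IsOpenQuotientMap.piMap fun _ => QuotientAddGroup.isOpenQuotientMap_mk

end Lattice

section Torus

variable {E : Type*} [NormedAddCommGroup E] [InnerProductSpace ℝ E]
variable {H : E → E} {K : NNReal} {Φ : Flow ℝ E} {φ : Flow ℝ (ℝ × E × ℝ)}

lemma IsConfined.flow (hH : LipschitzWith K H) (hΦ : IsFlowOf H Φ)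
    (hφ : IsFlowOf (reducedField H) φ) {b : ℝ × E × ℝ} (hb : IsConfined H Φ b) (t : ℝ) :
    IsConfined H Φ (φ t b) := by
  obtain ⟨α, β, hα, hβ, hvα, hvβ, hreg⟩ := hb
  have hmem := displacement_mem_Ioo hH hΦ hφ hα hβ hvα hvβ t
  set σ := (φ t b).1 - b.1
  have hshift : ∀ s, Φ s (φ t b).2.1 = Φ (s + σ) b.2.1 := fun s => by
    rw [reducedFlow_fst_snd hH hΦ hφ, Flow.map_add]
  refine ⟨α - σ, β - σ, by linarith [hmem.1], by linarith [hmem.2], ?_, ?_, ?_⟩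
  · rw [hshift, reducedEnergy_flow hφ, sub_add_cancel]; exact hvα
  · rw [hshift, reducedEnergy_flow hφ, sub_add_cancel]; exact hvβ
  · intro s hs
    rw [hshift, reducedEnergy_flow hφ]
    exact hreg (s + σ) ⟨by linarith [hs.1], by linarith [hs.2]⟩

lemma IsConfined.reducedField_ne_zero {b : ℝ × E × ℝ} (hb : IsConfined H Φ b) :
    reducedField H b ≠ 0 := by
  intro hzero
  obtain ⟨α, β, hα, hβ, -, -, hreg⟩ := hb
  refine hreg 0 ⟨hα.le, hβ.le⟩ ?_ ?_
  · have : b.2.2 = 0 := congrArg Prod.fst hzero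
    simp [reducedEnergy, this]
  · have : -inner ℝ (H b.2.1) b.2.1 = 0 := congrArg (fun x => x.2.2) hzero
    simpa using this

variable [FiniteDimensional ℝ E]

/-- The set of all points of the phase space `P` over the orbit of `b` under the reduced flow. -/
def orbitTorus (Γ : Submodule ℤ E) (P : Set (TM Γ)) (φ : Flow ℝ (ℝ × E × ℝ)) (b : ℝ × E × ℝ) :
    Set P :=
  {q | ∃ t, (q : TM Γ).2 = φ t b}

section Lift

variable (e : Module.Basis (Fin (Module.finrank ℝ E)) ℝ E) (L : E →L[ℝ] E)
  (φ : Flow ℝ (ℝ × E × ℝ)) (b : ℝ × E × ℝ) (T : ℝ)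

/-- The parametrization of an invariant torus over the orbit of `b` with period `T`. The first `n`
coordinates are those of `w` with respect to a lattice basis, and the last coordinate is the time on
the periodic orbit in units of `T`. The subtraction of the mean displacement makes the motion
linear. -/
def torusLift (x : Fin (Module.finrank ℝ E + 1) → ℝ) : TG E :=
  (∑ i, x i.castSucc • e i + (displacement L φ (T * x (Fin.last _)) b -
    x (Fin.last _) • displacement L φ T b), φ (T * x (Fin.last _)) b)

lemma contDiff_torusLift {r : ℕ∞} (hsm : ContDiff ℝ r fun t => φ t b) :
    ContDiff ℝ r (torusLift e L φ b T) := by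
  have hW : ContDiff ℝ r fun t => displacement L φ t b :=
    contDiff_of_hasDerivAt (hasDerivAt_displacement L φ b)
      (contDiff_exp_smul_apply L hsm.fst hsm.snd.fst)
  have hlast : ContDiff ℝ r fun x : Fin (Module.finrank ℝ E + 1) → ℝ => T * x (Fin.last _) := by
    fun_prop
  exact ((ContDiff.sum fun i _ => (contDiff_apply ℝ ℝ i.castSucc).smul contDiff_const).add
    ((hW.comp hlast).sub ((contDiff_apply ℝ ℝ (Fin.last _)).smul contDiff_const))).prodMk
    (hsm.comp hlast)

variable {e L φ b T}

lemma fderiv_torusLift_injective (hH : LipschitzWith K H) (hΦ : IsFlowOf H Φ)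
    (hφ : IsFlowOf (reducedField H) φ) (hb : IsConfined H Φ b) (hT : 0 < T)
    {x : Fin (Module.finrank ℝ E + 1) → ℝ} (hd : DifferentiableAt ℝ (torusLift e L φ b T) x) :
    Function.Injective (fderiv ℝ (torusLift e L φ b T) x) := by
  rw [injective_iff_map_eq_zero]
  intro v hv
  have hline : HasDerivAt (fun s : ℝ => torusLift e L φ b T (x + s • v)) 0 0 := by
    have h0 : HasDerivAt (fun s : ℝ => x + s • v) v 0 := by
      simpa using ((hasDerivAt_id (0 : ℝ)).smul_const v).const_add x
    have h1 : HasFDerivAt (torusLift e L φ b T) (fderiv ℝ (torusLift e L φ b T) x)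
        (x + (0 : ℝ) • v) := by simpa using hd.hasFDerivAt
    simpa [hv, Function.comp_def] using h1.comp_hasDerivAt (0 : ℝ) h0
  have hlast : v (Fin.last _) = 0 := by
    have h1 : HasDerivAt (fun s : ℝ => T * (x (Fin.last _) + s * v (Fin.last _)))
        (T * v (Fin.last _)) 0 := by
      simpa using (((hasDerivAt_id (0 : ℝ)).mul_const (v (Fin.last _))).const_add
        (x (Fin.last _))).const_mul T
    have h2 : HasDerivAt (fun s : ℝ => φ (T * (x (Fin.last _) + s * v (Fin.last _))) b)
        ((T * v (Fin.last _)) • reducedField H (φ (T * x (Fin.last _)) b)) 0 := by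
      have := hφ b (T * (x (Fin.last _) + 0 * v (Fin.last _)))
      rw [zero_mul, add_zero] at this
      refine HasDerivAt.scomp (g₁ := fun t => φ t b) (0 : ℝ) ?_ h1
      rwa [zero_mul, add_zero]
    have h4 : HasDerivAt (fun s : ℝ => (torusLift e L φ b T (x + s • v)).2) (0 : ℝ × E × ℝ) 0 :=
      hline.snd
    have h3 := h2.unique h4
    rcases smul_eq_zero.1 h3 with h | h
    · exact (mul_eq_zero.1 h).resolve_left hT.ne'
    · exact absurd h (hb.flow hH hΦ hφ _).reducedField_ne_zero
  have hsum : ∑ i, v i.castSucc • e i = 0 := by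
    have h1 : HasDerivAt (fun s : ℝ => (torusLift e L φ b T (x + s • v)).1)
        (∑ i, v i.castSucc • e i) 0 := by
      have : (fun s : ℝ => (torusLift e L φ b T (x + s • v)).1) =
          fun s : ℝ => (torusLift e L φ b T x).1 + s • ∑ i, v i.castSucc • e i := by
        funext s
        simp only [torusLift, Pi.add_apply, Pi.smul_apply, smul_eq_mul, hlast, mul_zero, add_zero,
          add_smul, Finset.sum_add_distrib, Finset.smul_sum, smul_smul]
        abel
      rw [this]
      simpa using ((hasDerivAt_id (0 : ℝ)).smul_const (∑ i, v i.castSucc • e i)).const_add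
        (torusLift e L φ b T x).1
    exact h1.unique hline.fst
  have hi : ∀ i, v (Fin.castSucc i) = 0 :=
    Fintype.linearIndependent_iff.1 e.linearIndependent (fun i => v i.castSucc) hsum
  funext j
  exact Fin.lastCases hlast hi j

lemma displacement_add_int_mul (hT : φ T b = b) (k : ℤ) (t : ℝ) :
    displacement L φ (t + k * T) b = displacement L φ t b + (k : ℝ) • displacement L φ T b := by
  have hfix : ∀ k : ℤ, φ (k * T) b = b := by
    have hn : ∀ n : ℕ, φ (n * T) b = b := fun n => by
      induction n with
      | zero => simp
      | succ n ih =>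
        rw [Nat.cast_succ, add_mul, one_mul, Flow.map_add, hT, ih]
    intro k
    obtain ⟨n, rfl | rfl⟩ := k.eq_nat_or_neg
    · exact_mod_cast hn n
    · conv_lhs => rw [← hn n]
      rw [← Flow.map_add]
      simp
  let f : ℤ →+ E := AddMonoidHom.mk' (fun k => displacement L φ (k * T) b) fun k l => by
    rw [Int.cast_add, add_mul, displacement_add, hfix, add_comm]
  have hf : displacement L φ (k * T) b = (k : ℝ) • displacement L φ T b := by
    have := f.map_zsmul k 1
    simp only [smul_eq_mul, mul_one] at this
    rw [show displacement L φ (k * T) b = f k from rfl, this, Int.cast_smul_eq_zsmul]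
    simp [f]
  rw [displacement_add, hfix, hf, add_comm]

lemma proj_torusLift_eq_iff (Γ : Submodule ℤ E) (he : ∀ x : E, x ∈ Γ ↔ ∀ i, ∃ k : ℤ, e.repr x i = k)
    (hT : 0 < T) (hper : ∀ s t, φ s b = φ t b ↔ ∃ k : ℤ, s - t = k * T)
    (x y : Fin (Module.finrank ℝ E + 1) → ℝ) :
    proj Γ (torusLift e L φ b T x) = proj Γ (torusLift e L φ b T y) ↔
      (fun i => (x i : UnitAddCircle)) = fun i => (y i : UnitAddCircle) := by
  have hTb : φ T b = b := by
    have := (hper T 0).2 ⟨1, by simp⟩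
    rwa [Flow.map_zero_apply] at this
  have h1 : proj Γ (torusLift e L φ b T x) = proj Γ (torusLift e L φ b T y) ↔
      (torusLift e L φ b T x).1 - (torusLift e L φ b T y).1 ∈ Γ ∧
        φ (T * x (Fin.last _)) b = φ (T * y (Fin.last _)) b := by
    rw [← Submodule.Quotient.eq, ← Prod.mk_inj]
    rfl
  have h2 : φ (T * x (Fin.last _)) b = φ (T * y (Fin.last _)) b ↔
      (x (Fin.last _) : UnitAddCircle) = y (Fin.last _) := by
    rw [hper, unitAddCircle_coe_eq_iff]
    refine exists_congr fun k => ?_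
    rw [← mul_sub, mul_comm, mul_left_inj' hT.ne']
  rw [h1, h2, funext_iff, Fin.forall_fin_succ', and_comm]
  rw [and_comm (b := (x (Fin.last _) : UnitAddCircle) = y (Fin.last _))]
  refine and_congr_right fun hlast => ?_
  obtain ⟨k, hk⟩ := unitAddCircle_coe_eq_iff.1 hlast
  have h3 : (torusLift e L φ b T x).1 - (torusLift e L φ b T y).1 =
      ∑ i : Fin (Module.finrank ℝ E), (x i.castSucc - y i.castSucc) • e i := by
    have hx : x (Fin.last _) = y (Fin.last _) + k := by linarith
    have : T * (y (Fin.last _) + k) = T * y (Fin.last _) + k * T := by ring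
    simp only [torusLift, hx, this, displacement_add_int_mul hTb, sub_smul, add_smul,
      Finset.sum_sub_distrib]
    abel
  rw [h3, he]
  refine forall_congr' fun i => ?_
  rw [unitAddCircle_coe_eq_iff, Module.Basis.repr_sum_self]

lemma torusLift_add_smul (hT : 0 < T) (t : ℝ) (x : Fin (Module.finrank ℝ E + 1) → ℝ) :
    torusLift e L φ b T (fun i => x i + t * (Fin.snoc (α := fun _ => ℝ)
      (fun i => e.repr (T⁻¹ • displacement L φ T b) i) T⁻¹ : Fin (Module.finrank ℝ E + 1) → ℝ) i) =
    ((torusLift e L φ b T x).1 + displacement L φ t (torusLift e L φ b T x).2,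
      φ t (torusLift e L φ b T x).2) := by
  have h1 : T * (x (Fin.last _) + t * T⁻¹) = t + T * x (Fin.last _) := by
    field_simp; ring
  have h2 : ∑ i : Fin (Module.finrank ℝ E),
      (x i.castSucc + t * e.repr (T⁻¹ • displacement L φ T b) i) • e i =
      ∑ i : Fin (Module.finrank ℝ E), x i.castSucc • e i + (t * T⁻¹) • displacement L φ T b := by
    simp only [add_smul, Finset.sum_add_distrib, mul_smul]
    rw [← Finset.smul_sum, e.sum_repr]
  refine Prod.ext ?_ ?_
  · simp only [torusLift, Fin.snoc_castSucc, Fin.snoc_last, h1]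
    rw [h2, displacement_add, add_smul]
    abel
  · simp only [torusLift, Fin.snoc_last, h1, Flow.map_add]

end Lift

/-- The set over a confined, hence periodic, orbit of the reduced system is a torus with
quasi-periodic motion. -/
lemma isQuasiPeriodicTorus_orbitTorus {r : ℕ∞} (hr : 1 ≤ r) (hH : LipschitzWith K H)
    (hΦ : IsFlowOf H Φ) (hφ : IsFlowOf (reducedField H) φ) (L : E →L[ℝ] E)
    (Γ : Submodule ℤ E) [DiscreteTopology Γ] [IsZLattice ℝ Γ] {P : Set (TM Γ)}
    (hP : ∀ p q : TM Γ, energy Γ p = energy Γ q → p ∈ P → q ∈ P) {p : TM Γ} (hp : p ∈ P)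
    (hb : IsConfined H Φ p.2) (hsm : ContDiff ℝ r fun t => φ t p.2) :
    IsQuasiPeriodicTorus r Γ P ((skewFlow Γ L φ).restrict (isInvariant_skewFlow Γ hφ L hP))
      (orbitTorus Γ P φ p.2) := by
  obtain ⟨e, he⟩ := exists_basis_of_isZLattice Γ
  obtain ⟨T, hT, hper⟩ := hb.exists_period hH hΦ hφ
  have := t2Space_quotient Γ
  set m := Module.finrank ℝ E + 1
  let π : (Fin m → ℝ) → (Fin m → UnitAddCircle) := fun x i => (x i : UnitAddCircle)
  have hπ : IsOpenQuotientMap π := isOpenQuotientMap_coe_pi m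
  let lift := torusLift e L φ p.2 T
  have hmem : ∀ x, proj Γ (lift x) ∈ P := fun x =>
    hP p _ (reducedEnergy_flow hφ p.2 _).symm hp
  have hiff := proj_torusLift_eq_iff (L := L) Γ he hT hper
  let emb : (Fin m → UnitAddCircle) → P := fun θ => ⟨proj Γ (lift (Function.surjInv hπ.surjective θ)),
    hmem _⟩
  have hemb : ∀ x, (emb (π x) : TM Γ) = proj Γ (lift x) := fun x =>
    (hiff _ _).2 (Function.surjInv_eq hπ.surjective (π x))
  have hlift : ContDiff ℝ r lift := contDiff_torusLift e L φ p.2 T hsm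
  have hprojc : Continuous (proj Γ) := by
    have h1 : Continuous fun x : E => (Submodule.Quotient.mk x : E ⧸ Γ) := continuous_quot_mk
    exact (h1.comp continuous_fst).prodMk continuous_snd
  have hcont : Continuous emb := by
    rw [hπ.isQuotientMap.continuous_iff]
    refine continuous_induced_rng.2 ?_
    have : Subtype.val ∘ emb ∘ π = proj Γ ∘ lift := funext hemb
    rw [this]
    exact hprojc.comp hlift.continuous
  have hinj : Function.Injective emb := by
    intro θ θ' h
    obtain ⟨x, rfl⟩ := hπ.surjective θ
    obtain ⟨y, rfl⟩ := hπ.surjective θ'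
    refine (hiff x y).1 ?_
    rw [← show (emb (π x) : TM Γ) = proj Γ (lift x) from hemb x,
      ← show (emb (π y) : TM Γ) = proj Γ (lift y) from hemb y, h]
  refine ⟨emb, lift, Fin.snoc (α := fun _ => ℝ)
    (fun i => e.repr (T⁻¹ • displacement L φ T p.2) i) T⁻¹,
    (hcont.isClosedEmbedding hinj).isEmbedding, ?_, hlift, fun x => ?_, hemb, fun t θ => ?_⟩
  · ext q
    constructor
    · rintro ⟨θ, rfl⟩
      exact ⟨_, rfl⟩
    · rintro ⟨t, ht⟩
      obtain ⟨w, hw⟩ := Submodule.Quotient.mk_surjective Γ (q : TM Γ).1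
      refine ⟨π (Fin.snoc (α := fun _ => ℝ) (fun i => e.repr (w - (displacement L φ t p.2 -
        (t / T) • displacement L φ T p.2)) i) (t / T)), Subtype.ext ?_⟩
      rw [hemb]
      have hTt : T * (t / T) = t := by field_simp
      have : lift (Fin.snoc (α := fun _ => ℝ) (fun i => e.repr (w - (displacement L φ t p.2 -
          (t / T) • displacement L φ T p.2)) i) (t / T)) = (w, φ t p.2) := by
        simp only [lift, torusLift, Fin.snoc_castSucc, Fin.snoc_last, hTt, e.sum_repr,
          sub_add_cancel]
      rw [this]
      exact Prod.ext hw ht.symm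
  · exact fderiv_torusLift_injective hH hΦ hφ hb hT (hlift.differentiable
      (by exact_mod_cast (zero_lt_one.trans_le hr).ne') x)
  · obtain ⟨x, rfl⟩ := hπ.surjective θ
    refine Subtype.ext ?_
    have h1 := torusLift_add_smul (e := e) (L := L) (φ := φ) (b := p.2) hT t x
    rw [Flow.coe_restrict_apply, skewFlow_apply]
    have h2 : (fun i => π x i + ((t * (Fin.snoc (α := fun _ => ℝ)
        (fun i => e.repr (T⁻¹ • displacement L φ T p.2) i) T⁻¹ : Fin m → ℝ) i : ℝ) :
          UnitAddCircle)) = π (fun i => x i + t * (Fin.snoc (α := fun _ => ℝ)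
        (fun i => e.repr (T⁻¹ • displacement L φ T p.2) i) T⁻¹ : Fin m → ℝ) i) := rfl
    rw [h2, hemb, hemb]
    change _ = proj Γ (torusLift e L φ p.2 T _)
    rw [h1]
    exact Prod.ext (Submodule.Quotient.mk_add Γ).symm rfl

end Torus

/-! ### Families of invariant tori and level sets -/

section

section Newton

/-- At the leftmost point of an orbit of a Newton equation, the potential decreases, so that just
left of this point it exceeds the energy. -/
lemma exists_forall_lt_potential_left {s η v g : ℝ → ℝ} {h : ℝ} (hs : ∀ t, HasDerivAt s (η t) t)
    (hη : ∀ t, HasDerivAt η (-g (s t)) t) (hen : ∀ t, η t ^ 2 + v (s t) = h)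
    (hv : ∀ x, HasDerivAt v (2 * g x) x) {t₀ : ℝ} (hmin : ∀ t, s t₀ ≤ s t) (hg : g (s t₀) ≠ 0) :
    ∃ α < s t₀, ∀ x ∈ Ioo α (s t₀), h < v x := by
  have hη0 : η t₀ = 0 :=
    IsLocalMin.hasDerivAt_eq_zero (Filter.Eventually.of_forall hmin) (hs t₀)
  have hvh : v (s t₀) = h := by simpa [hη0] using hen t₀
  rcases lt_or_gt_of_ne hg with hneg | hpos
  · have h1 := (hasDerivAt_iff_tendsto_slope.1 (hv (s t₀))).eventually_lt_const
      (by linarith : 2 * g (s t₀) < 0)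
    have h2 : ∀ᶠ x in 𝓝[<] (s t₀), slope v (s t₀) x < 0 :=
      h1.filter_mono (nhdsWithin_mono _ fun x hx => ne_of_lt hx)
    obtain ⟨α, hα, hα'⟩ := mem_nhdsLT_iff_exists_Ioo_subset.1 h2
    refine ⟨α, hα, fun x hx => ?_⟩
    have h3 : slope v (s t₀) x < 0 := hα' hx
    rw [slope_def_field, div_neg_iff] at h3
    rcases h3 with h3 | h3
    · linarith [h3.1]
    · linarith [h3.2, hx.2]
  · exfalso
    have h1 := (hasDerivAt_iff_tendsto_slope.1 (hη t₀)).eventually_lt_const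
      (by linarith : -g (s t₀) < 0)
    have h2 : ∀ᶠ x in 𝓝[>] t₀, slope η t₀ x < 0 :=
      h1.filter_mono (nhdsWithin_mono _ fun x hx => ne_of_gt hx)
    obtain ⟨t₁, ht₁, h3⟩ := mem_nhdsGT_iff_exists_Ioo_subset.1 h2
    have ht₁' : t₀ < t₁ := ht₁
    obtain ⟨c, hc, hc'⟩ := exists_hasDerivAt_eq_slope s η (left_lt_add_div_two.2 ht₁')
      (continuous_iff_continuousAt.2 fun t => (hs t).continuousAt).continuousOn (fun x _ => hs x)
    have hmid : (t₀ + t₁) / 2 < t₁ := by linarith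
    have h4 : slope η t₀ c < 0 := h3 ⟨hc.1, hc.2.trans hmid⟩
    rw [slope_def_field, hη0, sub_zero, hc'] at h4
    have h5 : 0 ≤ (s ((t₀ + t₁) / 2) - s t₀) / ((t₀ + t₁) / 2 - t₀) :=
      div_nonneg (sub_nonneg.2 (hmin _)) (by linarith)
    exact absurd h4 (not_lt.2 (div_nonneg h5 (sub_nonneg.2 hc.1.le)))

lemma exists_forall_lt_potential_right {s η v g : ℝ → ℝ} {h : ℝ} (hs : ∀ t, HasDerivAt s (η t) t)
    (hη : ∀ t, HasDerivAt η (-g (s t)) t) (hen : ∀ t, η t ^ 2 + v (s t) = h)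
    (hv : ∀ x, HasDerivAt v (2 * g x) x) {t₀ : ℝ} (hmax : ∀ t, s t ≤ s t₀) (hg : g (s t₀) ≠ 0) :
    ∃ β > s t₀, ∀ x ∈ Ioo (s t₀) β, h < v x := by
  obtain ⟨α, hα, hlt⟩ := exists_forall_lt_potential_left (s := fun t => -s t) (η := fun t => -η t)
    (v := fun x => v (-x)) (g := fun x => -g (-x)) (h := h) (t₀ := t₀) (fun t => (hs t).neg)
    (fun t => (hη t).neg.congr_deriv (by simp)) (fun t => by simpa using hen t)
    (fun x => by simpa [Function.comp_def] using (hv (-x)).scomp x (hasDerivAt_neg x))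
    (fun t => neg_le_neg (hmax t)) (by simpa using hg)
  refine ⟨-α, by linarith, fun x hx => ?_⟩
  simpa using hlt (-x) ⟨by linarith [hx.2], by linarith [hx.1]⟩

end Newton

variable {E : Type*} [NormedAddCommGroup E] [InnerProductSpace ℝ E]
variable {H : E → E} {K : NNReal} {Φ : Flow ℝ E} {φ : Flow ℝ (ℝ × E × ℝ)}

/-- The common level set through `b` of the energy and of the first integral `Φ^{-u}(ξ)`. -/
def reducedLevel (Φ : Flow ℝ E) (b : ℝ × E × ℝ) : Set (ℝ × E × ℝ) :=
  {c | reducedEnergy c = reducedEnergy b ∧ c.2.1 = Φ (c.1 - b.1) b.2.1}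

lemma reducedFlow_mem_reducedLevel (hH : LipschitzWith K H) (hΦ : IsFlowOf H Φ)
    (hφ : IsFlowOf (reducedField H) φ) (b : ℝ × E × ℝ) (t : ℝ) : φ t b ∈ reducedLevel Φ b :=
  ⟨reducedEnergy_flow hφ b t, reducedFlow_fst_snd hH hΦ hφ b t⟩

lemma reducedLevel_eq_of_mem {b c : ℝ × E × ℝ} (hc : c ∈ reducedLevel Φ b) :
    reducedLevel Φ c = reducedLevel Φ b := by
  ext d
  simp only [reducedLevel, mem_ofPred_eq, hc.1, hc.2, ← Flow.map_add, sub_add_sub_cancel]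

/-- A confined orbit is cut out of its level set by an open condition on `u`. -/
lemma IsConfined.exists_orbit_iff (hH : LipschitzWith K H) (hΦ : IsFlowOf H Φ)
    (hφ : IsFlowOf (reducedField H) φ) {b : ℝ × E × ℝ} (hb : IsConfined H Φ b) :
    ∃ α β : ℝ, ∀ c, (∃ t, c = φ t b) ↔ c ∈ reducedLevel Φ b ∧ c.1 - b.1 ∈ Ioo α β := by
  obtain ⟨T, hT, hper⟩ := hb.exists_period hH hΦ hφ
  obtain ⟨t₁, -, ht₁⟩ := hb.exists_turning_point hH hΦ hφ 0
  obtain ⟨α, β, hα, hβ, hvα, hvβ, hreg⟩ := hb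
  set s : ℝ → ℝ := fun t => (φ t b).1 - b.1 with hs
  have hscont : Continuous s := by fun_prop
  have hsper : Function.Periodic s T := fun t => by
    have := (hper (t + T) t).2 ⟨1, by simp⟩
    simp only [hs, this]
  have hcomp : IsCompact (range s) := hsper.compact_of_continuous hT.ne' hscont
  obtain ⟨_, ⟨tm, rfl⟩, hm⟩ := hcomp.exists_isLeast (range_nonempty s)
  obtain ⟨_, ⟨tM, rfl⟩, hM⟩ := hcomp.exists_isGreatest (range_nonempty s)
  replace hm : ∀ t, s tm ≤ s t := fun t => hm ⟨t, rfl⟩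
  replace hM : ∀ t, s t ≤ s tM := fun t => hM ⟨t, rfl⟩
  have hsd : ∀ t, HasDerivAt s (φ t b).2.2 t :=
    fun t => (hasDerivAt_fst_reducedFlow hφ b t).sub_const _
  have hηd : ∀ t, HasDerivAt (fun t => (φ t b).2.2)
      (-(fun x => inner ℝ (H (Φ x b.2.1)) (Φ x b.2.1)) (s t)) t := fun t => by
    have := hasDerivAt_snd_snd_reducedFlow hφ b t
    rwa [reducedFlow_fst_snd hH hΦ hφ b t] at this
  have hen := energy_identity hH hΦ hφ b
  have hgne : ∀ t, (φ t b).2.2 = 0 → inner ℝ (H (Φ (s t) b.2.1)) (Φ (s t) b.2.1) ≠ 0 := by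
    intro t ht
    refine hreg _ (Ioo_subset_Icc_self (displacement_mem_Ioo hH hΦ hφ hα hβ hvα hvβ t)) ?_
    have := hen t
    rw [ht] at this
    simpa using this
  have hηm : (φ tm b).2.2 = 0 :=
    IsLocalMin.hasDerivAt_eq_zero (Filter.Eventually.of_forall hm) (hsd tm)
  have hηM : (φ tM b).2.2 = 0 :=
    IsLocalMax.hasDerivAt_eq_zero (Filter.Eventually.of_forall hM) (hsd tM)
  obtain ⟨α', hα', hvα'⟩ := exists_forall_lt_potential_left hsd hηd hen
    (hasDerivAt_norm_sq_flow hΦ b.2.1) hm (hgne tm hηm)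
  obtain ⟨β', hβ', hvβ'⟩ := exists_forall_lt_potential_right hsd hηd hen
    (hasDerivAt_norm_sq_flow hΦ b.2.1) hM (hgne tM hηM)
  refine ⟨α', β', fun c => ⟨?_, fun ⟨hc, hcI⟩ => ?_⟩⟩
  · rintro ⟨t, rfl⟩
    exact ⟨reducedFlow_mem_reducedLevel hH hΦ hφ b t, hα'.trans_le (hm t), (hM t).trans_lt hβ'⟩
  · have hle : ‖Φ (c.1 - b.1) b.2.1‖ ^ 2 + c.2.2 ^ 2 = reducedEnergy b := by
      rw [← hc.1, reducedEnergy, hc.2]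
    have h1 : s tm ≤ c.1 - b.1 := by
      by_contra! hlt
      have := hvα' _ ⟨hcI.1, hlt⟩
      nlinarith [sq_nonneg c.2.2]
    have h2 : c.1 - b.1 ≤ s tM := by
      by_contra! hlt
      have := hvβ' _ ⟨hlt, hcI.2⟩
      nlinarith [sq_nonneg c.2.2]
    obtain ⟨t, ht⟩ := mem_range_of_exists_le_of_exists_ge hscont ⟨tm, h1⟩ ⟨tM, h2⟩
    have hc1 : c.1 = (φ t b).1 := by linarith [show (φ t b).1 - b.1 = c.1 - b.1 from ht]
    have hc2 : c.2.1 = (φ t b).2.1 := by rw [hc.2, reducedFlow_fst_snd hH hΦ hφ, hc1]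
    have hsq : c.2.2 ^ 2 = (φ t b).2.2 ^ 2 := by
      have := hen t
      rw [show (φ t b).1 - b.1 = c.1 - b.1 from ht] at this
      linarith
    rcases sq_eq_sq_iff_eq_or_eq_neg.1 hsq with h | h
    · exact ⟨t, Prod.ext hc1 (Prod.ext hc2 h)⟩
    · refine ⟨2 * t₁ - t, ?_⟩
      rw [reducedFlow_reflect hH hφ ht₁]
      exact Prod.ext hc1 (Prod.ext hc2 h)

/-- For times in a compact interval, the absence of tangencies to the sphere of radius `√h`, where
`h` is the energy of `b`, is stable under perturbations of `b`. -/
lemma eventually_not_tangent (hH : LipschitzWith K H) {b : ℝ × E × ℝ} {α β : ℝ}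
    (hreg : ∀ s ∈ Icc α β, ‖Φ s b.2.1‖ ^ 2 = reducedEnergy b →
      inner ℝ (H (Φ s b.2.1)) (Φ s b.2.1) ≠ 0) :
    ∀ᶠ c in 𝓝 b, ∀ s ∈ Icc α β, ‖Φ s c.2.1‖ ^ 2 = reducedEnergy c →
      inner ℝ (H (Φ s c.2.1)) (Φ s c.2.1) ≠ 0 := by
  have hE : Continuous (reducedEnergy : ℝ × E × ℝ → ℝ) := continuous_reducedEnergy
  have hΦ : Continuous fun p : (ℝ × E × ℝ) × ℝ => Φ p.2 p.1.2.1 := by fun_prop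
  have hcomp : ∀ᶠ c in 𝓝 b, ∀ s ∈ Icc α β, ¬(‖Φ s c.2.1‖ ^ 2 = reducedEnergy c ∧
      inner ℝ (H (Φ s c.2.1)) (Φ s c.2.1) = (0 : ℝ)) := by
    refine isCompact_Icc.eventually_forall_of_forall_eventually fun s hs => ?_
    have hclosed : IsClosed {p : (ℝ × E × ℝ) × ℝ | ‖Φ p.2 p.1.2.1‖ ^ 2 = reducedEnergy p.1 ∧
        inner ℝ (H (Φ p.2 p.1.2.1)) (Φ p.2 p.1.2.1) = (0 : ℝ)} :=
      (isClosed_eq (by fun_prop) (hE.comp continuous_fst)).inter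
        (isClosed_eq ((hH.continuous.comp hΦ).inner hΦ) continuous_const)
    exact hclosed.isOpen_compl.mem_nhds fun h => hreg s hs h.1 h.2
  filter_upwards [hcomp] with c hc s hs h h' using hc s hs ⟨h, h'⟩

lemma isOpen_setOf_isConfined (hH : LipschitzWith K H) : IsOpen {b | IsConfined H Φ b} := by
  rw [isOpen_iff_mem_nhds]
  rintro b ⟨α, β, hα, hβ, hvα, hvβ, hreg⟩
  have hE : Continuous (reducedEnergy : ℝ × E × ℝ → ℝ) := continuous_reducedEnergy
  have h1 : ∀ᶠ c in 𝓝 b, reducedEnergy c < ‖Φ α c.2.1‖ ^ 2 :=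
    hE.continuousAt.eventually_lt (by fun_prop) hvα
  have h2 : ∀ᶠ c in 𝓝 b, reducedEnergy c < ‖Φ β c.2.1‖ ^ 2 :=
    hE.continuousAt.eventually_lt (by fun_prop) hvβ
  filter_upwards [eventually_not_tangent hH hreg, h1, h2] with c hc hc1 hc2
  exact ⟨α, β, hα, hβ, hc1, hc2, hc⟩

variable [FiniteDimensional ℝ E]

lemma orbitTorus_eq (Γ : Submodule ℤ E) (P : Set (TM Γ)) {b c : ℝ × E × ℝ} {s t : ℝ}
    (h : φ s b = φ t c) : orbitTorus Γ P φ b = orbitTorus Γ P φ c := by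
  have key : ∀ {b c : ℝ × E × ℝ} {s t : ℝ}, φ s b = φ t c →
      orbitTorus Γ P φ b ⊆ orbitTorus Γ P φ c := by
    rintro b c s t h q ⟨τ, hq⟩
    refine ⟨τ - s + t, ?_⟩
    rw [hq, Flow.map_add, ← h, ← Flow.map_add, sub_add_cancel]
  exact (key h).antisymm (key h.symm)

/-- The tori over the orbits in `U`. -/
def torusFamily (Γ : Submodule ℤ E) (P : Set (TM Γ)) (φ : Flow ℝ (ℝ × E × ℝ))
    (U : Set (ℝ × E × ℝ)) : Set (Set P) :=
  {T | ∃ p : P, (p : TM Γ).2 ∈ U ∧ T = orbitTorus Γ P φ (p : TM Γ).2}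

lemma sUnion_torusFamily (Γ : Submodule ℤ E) (P : Set (TM Γ)) {U : Set (ℝ × E × ℝ)}
    (hU : ∀ b ∈ U, ∀ t, φ t b ∈ U) :
    ⋃₀ torusFamily Γ P φ U = {p : P | (p : TM Γ).2 ∈ U} := by
  ext q
  constructor
  · rintro ⟨_, ⟨p, hp, rfl⟩, t, ht⟩
    change (q : TM Γ).2 ∈ U
    rw [ht]
    exact hU _ hp t
  · intro hq
    exact ⟨_, ⟨q, hq, rfl⟩, 0, (Flow.map_zero_apply _ _).symm⟩

/-- An open, dense and invariant set of confined points is filled with invariant tori. -/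
lemma isTorusFamily_torusFamily {r : ℕ∞} (hr : 1 ≤ r) (hH : LipschitzWith K H)
    (hΦ : IsFlowOf H Φ) (hφ : IsFlowOf (reducedField H) φ) (L : E →L[ℝ] E)
    (Γ : Submodule ℤ E) [DiscreteTopology Γ] [IsZLattice ℝ Γ] {P : Set (TM Γ)}
    (hP : ∀ p q : TM Γ, energy Γ p = energy Γ q → p ∈ P → q ∈ P)
    (hsm : ∀ p ∈ P, ContDiff ℝ r fun t => φ t p.2) {U : Set (ℝ × E × ℝ)} (hUo : IsOpen U)
    (hUinv : ∀ b ∈ U, ∀ t, φ t b ∈ U) (hUc : ∀ b ∈ U, IsConfined H Φ b)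
    (hUd : Dense {p : P | (p : TM Γ).2 ∈ U}) :
    IsTorusFamily r Γ P ((skewFlow Γ L φ).restrict (isInvariant_skewFlow Γ hφ L hP))
      (torusFamily Γ P φ U) where
  torus := by
    rintro _ ⟨p, hp, rfl⟩
    exact isQuasiPeriodicTorus_orbitTorus hr hH hΦ hφ L Γ hP p.2 (hUc _ hp) (hsm p p.2)
  disjoint := by
    rintro _ ⟨p, hp, rfl⟩ _ ⟨p', hp', rfl⟩ hne
    rw [Function.onFun, disjoint_left]
    rintro q ⟨s, hs⟩ ⟨t, ht⟩
    exact hne (orbitTorus_eq Γ P (hs.symm.trans ht))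
  isOpen := by
    rw [sUnion_torusFamily Γ P hUinv]
    exact hUo.preimage (continuous_subtype_val.snd)
  dense := by
    rw [sUnion_torusFamily Γ P hUinv]
    exact hUd

lemma IsQuasiPeriodicTorus.isCompact {r : ℕ∞} {Γ : Submodule ℤ E} {P : Set (TM Γ)} {Ψ : Flow ℝ P}
    {T : Set P} (h : IsQuasiPeriodicTorus r Γ P Ψ T) : IsCompact T := by
  obtain ⟨e, -, -, he, rfl, -⟩ := h
  exact isCompact_range he.continuous

lemma IsQuasiPeriodicTorus.isPreconnected {r : ℕ∞} {Γ : Submodule ℤ E} {P : Set (TM Γ)}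
    {Ψ : Flow ℝ P} {T : Set P} (h : IsQuasiPeriodicTorus r Γ P Ψ T) : IsPreconnected T := by
  obtain ⟨e, -, -, he, rfl, -⟩ := h
  exact isPreconnected_range he.continuous

/-- The torus through `p` is the connected component of `p` in the common level set of the first
integrals: it is compact and relatively open in the level set. -/
lemma orbitTorus_eq_connectedComponentIn {r : ℕ∞} (hH : LipschitzWith K H)
    (hΦ : IsFlowOf H Φ) (hφ : IsFlowOf (reducedField H) φ)
    {Γ : Submodule ℤ E} [DiscreteTopology Γ] {P : Set (TM Γ)} {Ψ : Flow ℝ P} {p : P}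
    (hb : IsConfined H Φ (p : TM Γ).2)
    (hT : IsQuasiPeriodicTorus r Γ P Ψ (orbitTorus Γ P φ (p : TM Γ).2)) :
    orbitTorus Γ P φ (p : TM Γ).2 =
      connectedComponentIn {q : P | (q : TM Γ).2 ∈ reducedLevel Φ (p : TM Γ).2} p := by
  have := t2Space_quotient Γ
  obtain ⟨α, β, hαβ⟩ := hb.exists_orbit_iff hH hΦ hφ
  have hpT : p ∈ orbitTorus Γ P φ (p : TM Γ).2 := ⟨0, (Flow.map_zero_apply _ _).symm⟩
  set Λ := {q : P | (q : TM Γ).2 ∈ reducedLevel Φ (p : TM Γ).2}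
  have hTΛ : orbitTorus Γ P φ (p : TM Γ).2 ⊆ Λ := fun q hq => ((hαβ _).1 hq).1
  refine (hT.isPreconnected.subset_connectedComponentIn hpT hTΛ).antisymm fun q hq => ?_
  by_contra hqT
  set O := {q : P | (q : TM Γ).2.1 - (p : TM Γ).2.1 ∈ Ioo α β}
  have hO : IsOpen O := isOpen_Ioo.preimage
    ((continuous_subtype_val.snd.fst : Continuous fun q : P => (q : TM Γ).2.1).sub continuous_const)
  have hOT : ∀ x ∈ Λ, x ∈ O → x ∈ orbitTorus Γ P φ (p : TM Γ).2 := fun x h1 h2 =>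
    (hαβ _).2 ⟨h1, h2⟩
  obtain ⟨x, hx, hxO, hxT⟩ := isPreconnected_connectedComponentIn (x := p) (F := Λ) O
    (orbitTorus Γ P φ (p : TM Γ).2)ᶜ hO hT.isCompact.isClosed.isOpen_compl
    (fun x _ => by
      by_cases hx : x ∈ orbitTorus Γ P φ (p : TM Γ).2
      · exact Or.inl ((hαβ _).1 hx).2
      · exact Or.inr hx)
    ⟨p, mem_connectedComponentIn (hTΛ hpT), ((hαβ _).1 hpT).2⟩ ⟨q, hq, hqT⟩
  exact hxT (hOT x (connectedComponentIn_subset _ _ hx) hxO)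

/-- A compact level set that consists of confined points is a finite union of tori. -/
lemma finite_orbitTorus_of_isCompact (hH : LipschitzWith K H)
    (hΦ : IsFlowOf H Φ) (hφ : IsFlowOf (reducedField H) φ)
    (Γ : Submodule ℤ E) (P : Set (TM Γ)) {b : ℝ × E × ℝ}
    (hcomp : IsCompact (reducedLevel Φ b)) (hconf : ∀ c ∈ reducedLevel Φ b, IsConfined H Φ c) :
    (orbitTorus Γ P φ '' reducedLevel Φ b).Finite := by
  have hex : ∀ c, ∃ α β : ℝ, c ∈ reducedLevel Φ b → ∀ d, (∃ t, d = φ t c) ↔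
      d ∈ reducedLevel Φ c ∧ d.1 - c.1 ∈ Ioo α β := fun c => by
    by_cases hc : c ∈ reducedLevel Φ b
    · obtain ⟨α, β, h⟩ := (hconf c hc).exists_orbit_iff hH hΦ hφ
      exact ⟨α, β, fun _ => h⟩
    · exact ⟨0, 0, fun h => absurd h hc⟩
  choose α β hαβ using hex
  obtain ⟨t, ht, hcov⟩ := hcomp.elim_nhds_subcover (fun c => {d | d.1 - c.1 ∈ Ioo (α c) (β c)})
    fun c hc => (isOpen_Ioo.preimage (by fun_prop : Continuous fun d : ℝ × E × ℝ => d.1 - c.1)).mem_nhds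
      ((hαβ c hc c).1 ⟨0, (Flow.map_zero_apply _ _).symm⟩).2
  refine (t.finite_toSet.image (orbitTorus Γ P φ)).subset ?_
  rintro _ ⟨d, hd, rfl⟩
  obtain ⟨c, hc, hdc⟩ := mem_iUnion₂.1 (hcov hd)
  obtain ⟨τ, hτ⟩ := (hαβ c (ht c hc) d).2 ⟨by rwa [reducedLevel_eq_of_mem (ht c hc)], hdc⟩
  exact ⟨c, hc, orbitTorus_eq Γ P (s := τ) (t := 0) (by rw [Flow.map_zero_apply, hτ])⟩

end

/-! ### Orbits tangent to a sphere -/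

section Tangency

open MeasureTheory

variable {E : Type*} [NormedAddCommGroup E] [InnerProductSpace ℝ E] [FiniteDimensional ℝ E]
variable {H : E → E} {K : NNReal} {Φ : Flow ℝ E}

lemma lipschitzWith_flow (hH : LipschitzWith K H) (hΦ : IsFlowOf H Φ) {t A : ℝ} (ht : |t| ≤ A) :
    LipschitzWith (Real.exp (K * A)).toNNReal (Φ t) := by
  refine LipschitzWith.of_dist_le_mul fun x y => ?_
  have h := dist_integralCurve_le hH (hΦ x) (hΦ y) t
  rw [Flow.map_zero_apply, Flow.map_zero_apply] at h
  rw [Real.coe_toNNReal _ (Real.exp_pos _).le, mul_comm]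
  refine h.trans ?_
  gcongr

lemma addHaar_shell_le [Nontrivial E] [MeasurableSpace E] [BorelSpace E] (μ : Measure E)
    [μ.IsAddHaarMeasure] {ρ x : ℝ} (hx : 0 ≤ x) (hxρ : x ≤ ρ) :
    μ {y : E | |‖y‖ - ρ| ≤ x} ≤
      ENNReal.ofReal (2 * x * Module.finrank ℝ E * (2 * ρ) ^ (Module.finrank ℝ E - 1)) *
        μ (Metric.ball 0 1) := by
  have hsub : {y : E | |‖y‖ - ρ| ≤ x} ⊆
      Metric.closedBall 0 (ρ + x) \ Metric.ball 0 (ρ - x) := by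
    intro y hy
    have := abs_le.1 (show |‖y‖ - ρ| ≤ x from hy)
    simp only [mem_sdiff, Metric.mem_closedBall, Metric.mem_ball, dist_zero_right, not_lt]
    constructor <;> linarith
  refine (measure_mono hsub).trans ?_
  rw [measure_sdiff (Metric.ball_subset_ball (by linarith) |>.trans Metric.ball_subset_closedBall)
    measurableSet_ball.nullMeasurableSet measure_ball_lt_top.ne,
    Measure.addHaar_closedBall μ 0 (by linarith : 0 ≤ ρ + x),
    Measure.addHaar_ball μ 0 (by linarith : 0 ≤ ρ - x),
    ← ENNReal.sub_mul (fun _ _ => measure_ball_lt_top.ne),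
    ← ENNReal.ofReal_sub _ (pow_nonneg (by linarith) _)]
  gcongr
  refine (le_abs_self _).trans ((abs_pow_sub_pow_le _ _ _).trans ?_)
  have h1 : |ρ + x - (ρ - x)| = 2 * x := by
    rw [show ρ + x - (ρ - x) = 2 * x by ring, abs_of_nonneg (by linarith)]
  have h2 : max |ρ + x| |ρ - x| ≤ 2 * ρ := by
    rw [abs_of_nonneg (by linarith), abs_of_nonneg (by linarith)]
    exact max_le (by linarith) (by linarith)
  rw [h1]
  gcongr

/-- An orbit tangent to the sphere of radius `ρ` stays close to the sphere to second order,
uniformly in the point of tangency. -/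
lemma exists_abs_norm_flow_sub_le (hH : LipschitzWith K H) (hΦ : IsFlowOf H Φ) {ρ : ℝ}
    (hρ : 0 < ρ) : ∃ C : ℝ, 0 ≤ C ∧ ∀ z : E, ‖z‖ = ρ → inner ℝ (H z) z = 0 → ∀ τ : ℝ, |τ| ≤ 1 →
      |‖Φ τ z‖ - ρ| ≤ C * τ ^ 2 := by
  have hcomp : IsCompact ((fun p : ℝ × E => Φ p.1 p.2) '' (Icc (-1) 1 ×ˢ Metric.sphere 0 ρ)) :=
    (isCompact_Icc.prod (isCompact_sphere 0 ρ)).image (by fun_prop)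
  obtain ⟨R, hR⟩ := hcomp.isBounded.exists_norm_le
  obtain ⟨M, hM⟩ := (hcomp.image hH.continuous).isBounded.exists_norm_le
  have hR' : ∀ z : E, ‖z‖ = ρ → ∀ τ ∈ Icc (-1 : ℝ) 1, ‖Φ τ z‖ ≤ R := fun z hz τ hτ =>
    hR _ ⟨(τ, z), ⟨hτ, by simpa using hz⟩, rfl⟩
  have hM' : ∀ z : E, ‖z‖ = ρ → ∀ τ ∈ Icc (-1 : ℝ) 1, ‖H (Φ τ z)‖ ≤ M := fun z hz τ hτ =>
    hM _ ⟨_, ⟨(τ, z), ⟨hτ, by simpa using hz⟩, rfl⟩, rfl⟩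
  set A := |R|
  set B := |M|
  refine ⟨2 * ((K * A + B) * B) / ρ, by positivity, fun z hz hz0 τ hτ => ?_⟩
  have hτI : ∀ s ∈ Icc (-|τ|) |τ|, s ∈ Icc (-1 : ℝ) 1 := fun s hs =>
    ⟨by linarith [hs.1], by linarith [hs.2]⟩
  have h0mem : (0 : ℝ) ∈ Icc (-|τ|) |τ| := ⟨by simp, abs_nonneg τ⟩
  have hτmem : τ ∈ Icc (-|τ|) |τ| := ⟨neg_abs_le τ, le_abs_self τ⟩
  have h1 : ∀ s ∈ Icc (-|τ|) |τ|, ‖Φ s z - z‖ ≤ B * |τ| := by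
    intro s hs
    have := (convex_Icc (-|τ|) |τ|).norm_image_sub_le_of_norm_hasDerivWithin_le
      (f := fun s => Φ s z) (C := B) (fun x _ => (hΦ z x).hasDerivWithinAt)
      (fun x hx => (hM' z hz x (hτI x hx)).trans (le_abs_self M)) h0mem hs
    simp only [Flow.map_zero_apply, sub_zero] at this
    refine this.trans (mul_le_mul_of_nonneg_left ?_ (abs_nonneg M))
    exact abs_le.2 hs
  have h2 : ∀ s ∈ Icc (-|τ|) |τ|, ‖(2 * inner ℝ (H (Φ s z)) (Φ s z) : ℝ)‖ ≤
      2 * ((K * A + B) * (B * |τ|)) := by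
    intro s hs
    have e : inner ℝ (H (Φ s z)) (Φ s z) =
        inner ℝ (H (Φ s z) - H z) (Φ s z) + inner ℝ (H z) (Φ s z - z) := by
      rw [inner_sub_left, inner_sub_right, hz0]; ring
    have e1 : ‖H (Φ s z) - H z‖ ≤ K * (B * |τ|) := by
      have := hH.dist_le_mul (Φ s z) z
      rw [dist_eq_norm, dist_eq_norm] at this
      exact this.trans (mul_le_mul_of_nonneg_left (h1 s hs) K.coe_nonneg)
    have e2 : ‖Φ s z‖ ≤ A := (hR' z hz s (hτI s hs)).trans (le_abs_self R)
    have e3 : ‖H z‖ ≤ B := by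
      have := hM' z hz 0 ⟨by norm_num, by norm_num⟩
      rw [Flow.map_zero_apply] at this
      exact this.trans (le_abs_self M)
    rw [norm_mul, Real.norm_ofNat, e]
    refine mul_le_mul_of_nonneg_left ?_ zero_le_two
    have e4 : ‖(inner ℝ (H (Φ s z) - H z) (Φ s z) : ℝ)‖ ≤ K * (B * |τ|) * A :=
      (norm_inner_le_norm _ _).trans (by gcongr)
    have e5 : ‖(inner ℝ (H z) (Φ s z - z) : ℝ)‖ ≤ B * (B * |τ|) :=
      (norm_inner_le_norm _ _).trans (by gcongr; exact h1 s hs)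
    refine (norm_add_le _ _).trans ((add_le_add e4 e5).trans (le_of_eq (by ring)))
  have h3 := (convex_Icc (-|τ|) |τ|).norm_image_sub_le_of_norm_hasDerivWithin_le
    (f := fun s => ‖Φ s z‖ ^ 2) (fun x _ => (hasDerivAt_norm_sq_flow hΦ z x).hasDerivWithinAt)
    h2 h0mem hτmem
  simp only [Flow.map_zero_apply, sub_zero, hz, Real.norm_eq_abs] at h3
  have h4 : |‖Φ τ z‖ - ρ| * ρ ≤ |‖Φ τ z‖ ^ 2 - ρ ^ 2| := by
    rw [sq_sub_sq, abs_mul, mul_comm, abs_of_nonneg (by positivity : 0 ≤ ‖Φ τ z‖ + ρ)]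
    gcongr
    linarith [norm_nonneg (Φ τ z)]
  rw [div_mul_eq_mul_div, le_div_iff₀ hρ]
  refine h4.trans (h3.trans (le_of_eq ?_))
  rw [← sq_abs τ]
  ring

/-- The orbits that are tangent to a given sphere form a null set. As the vector field is only
Lipschitz, Sard's theorem does not apply, but during a time `δ` the tangency set sweeps out a set
that lies in a shell of thickness `O(δ²)`. -/
lemma dense_not_tangent [Nontrivial E] (hH : LipschitzWith K H) (hΦ : IsFlowOf H Φ) {ρ : ℝ}
    (hρ : 0 < ρ) : Dense {ξ : E | ∀ s, ‖Φ s ξ‖ = ρ → inner ℝ (H (Φ s ξ)) (Φ s ξ) ≠ 0} := by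
  let _ : MeasurableSpace E := borel E
  have : BorelSpace E := ⟨rfl⟩
  let μ : Measure E := Measure.hausdorffMeasure (Module.finrank ℝ E : ℝ)
  obtain ⟨C, hC0, hC⟩ := exists_abs_norm_flow_sub_le hH hΦ hρ
  let N : ℝ → Set E := fun a =>
    {ξ | ∃ s ∈ Icc a (a + 1), ‖Φ s ξ‖ = ρ ∧ inner ℝ (H (Φ s ξ)) (Φ s ξ) = 0}
  suffices hN : ∀ a, μ (N a) = 0 by
    refine Measure.dense_of_ae (μ := μ) ?_
    rw [ae_iff]
    refine measure_mono_null ?_ (measure_iUnion_null fun k : ℤ => hN k)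
    intro ξ hξ
    simp only [ne_eq, not_forall, not_not, mem_ofPred_eq] at hξ
    obtain ⟨s, hs, hs0⟩ := hξ
    exact mem_iUnion.2 ⟨⌊s⌋, s, ⟨Int.floor_le s, (Int.lt_floor_add_one s).le⟩, hs, hs0⟩
  intro a
  set n := Module.finrank ℝ E
  set Λ : NNReal := (Real.exp (K * (|a| + 1))).toNNReal
  set D : ENNReal := (Λ : ENNReal) ^ (n : ℝ) * μ (Metric.ball 0 1)
  have hD : D ≠ ⊤ := ENNReal.mul_ne_top
    (ENNReal.rpow_lt_top_of_nonneg (Nat.cast_nonneg n) ENNReal.coe_ne_top).ne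
    measure_ball_lt_top.ne
  have hbound : ∀ m : ℕ, 0 < m → C * (1 / (m : ℝ)) ^ 2 ≤ ρ → μ (N a) ≤
      ENNReal.ofReal ((m + 1) * (2 * (C * (1 / (m : ℝ)) ^ 2) * n * (2 * ρ) ^ (n - 1))) * D := by
    intro m hm hmρ
    have hm' : (0 : ℝ) < m := Nat.cast_pos.2 hm
    set x := C * (1 / (m : ℝ)) ^ 2 with hx
    have hx0 : 0 ≤ x := by positivity
    have hcov : N a ⊆ ⋃ j ∈ Finset.range (m + 1),
        Φ (-(a + j / m)) '' {y : E | |‖y‖ - ρ| ≤ x} := by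
      rintro ξ ⟨s, hs, hsρ, hs0⟩
      have hsa : 0 ≤ (s - a) * m := mul_nonneg (by linarith [hs.1]) hm'.le
      set j := ⌊(s - a) * m⌋₊
      have hj1 : (j : ℝ) ≤ (s - a) * m := Nat.floor_le hsa
      have hj2 : (s - a) * m < j + 1 := Nat.lt_floor_add_one _
      have hjm : j ≤ m := by
        refine Nat.floor_le_of_le ?_
        nlinarith [hs.2]
      have hτ0 : 0 ≤ s - (a + j / m) := by
        have : (j : ℝ) / m ≤ s - a := (div_le_iff₀ hm').2 hj1
        linarith
      have hτ1 : s - (a + j / m) ≤ 1 / m := by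
        have : s - a ≤ (j + 1) / m := (le_div_iff₀ hm').2 hj2.le
        rw [add_div] at this
        linarith
      have hm1 : 1 / (m : ℝ) ≤ 1 := by
        rw [div_le_one hm']; exact_mod_cast hm
      refine mem_biUnion (Finset.mem_range.2 (Nat.lt_succ_of_le hjm))
        ⟨Φ (-(s - (a + j / m))) (Φ s ξ), ?_, ?_⟩
      · have := hC (Φ s ξ) hsρ hs0 (-(s - (a + j / m))) (by
          rw [abs_neg, abs_of_nonneg hτ0]; linarith)
        refine this.trans ?_
        rw [neg_sq, hx]
        gcongr
      · rw [← Flow.map_add, ← Flow.map_add]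
        have : -(a + (j : ℝ) / m) + -(s - (a + j / m)) + s = 0 := by ring
        rw [this, Flow.map_zero_apply]
    have hpiece : ∀ j ∈ Finset.range (m + 1), μ (Φ (-(a + j / m)) '' {y : E | |‖y‖ - ρ| ≤ x}) ≤
        ENNReal.ofReal (2 * x * n * (2 * ρ) ^ (n - 1)) * D := by
      intro j hj
      have hjm : (j : ℝ) ≤ m := by exact_mod_cast Nat.lt_succ_iff.1 (Finset.mem_range.1 hj)
      have hj1 : (j : ℝ) / m ≤ 1 := (div_le_one hm').2 hjm
      have hj0 : 0 ≤ (j : ℝ) / m := by positivity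
      have habs : |-(a + (j : ℝ) / m)| ≤ |a| + 1 := by
        rw [abs_neg]
        refine (abs_add_le _ _).trans ?_
        rw [abs_of_nonneg hj0]
        linarith
      refine ((lipschitzWith_flow hH hΦ habs).hausdorffMeasure_image_le (Nat.cast_nonneg n)
        _).trans ?_
      refine (mul_le_mul_right (addHaar_shell_le μ hx0 hmρ) _).trans (le_of_eq ?_)
      simp only [D]
      ring
    refine (measure_mono hcov).trans ((measure_biUnion_finset_le _ _).trans
      ((Finset.sum_le_sum hpiece).trans ?_))
    rw [Finset.sum_const, Finset.card_range, nsmul_eq_mul, ← mul_assoc]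
    refine mul_le_mul_left (le_of_eq ?_) D
    rw [ENNReal.ofReal_mul (by positivity : (0 : ℝ) ≤ m + 1), ← Nat.cast_succ,
      ENNReal.ofReal_natCast]
  have hlim1 : Filter.Tendsto (fun m : ℕ => 1 / (m : ℝ)) Filter.atTop (𝓝 0) :=
    tendsto_one_div_atTop_nhds_zero_nat
  have hlim2 : Filter.Tendsto (fun m : ℕ => C * (1 / (m : ℝ)) ^ 2) Filter.atTop (𝓝 0) := by
    simpa using (hlim1.pow 2).const_mul C
  have hlim3 : Filter.Tendsto (fun m : ℕ => ((m : ℝ) + 1) *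
      (2 * (C * (1 / (m : ℝ)) ^ 2) * n * (2 * ρ) ^ (n - 1))) Filter.atTop (𝓝 0) := by
    have h : Filter.Tendsto (fun m : ℕ => (1 / (m : ℝ) + (1 / (m : ℝ)) ^ 2) *
        (2 * C * n * (2 * ρ) ^ (n - 1))) Filter.atTop (𝓝 0) := by
      simpa using (hlim1.add (hlim1.pow 2)).mul_const (2 * C * n * (2 * ρ) ^ (n - 1))
    refine h.congr' ?_
    filter_upwards [Filter.eventually_gt_atTop 0] with m hm
    have hm' : (m : ℝ) ≠ 0 := Nat.cast_ne_zero.2 hm.ne'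
    field_simp
  have hlim4 := ENNReal.Tendsto.mul_const (ENNReal.tendsto_ofReal hlim3)
    (Or.inr hD : ENNReal.ofReal 0 ≠ 0 ∨ D ≠ ⊤)
  rw [ENNReal.ofReal_zero, zero_mul] at hlim4
  refine le_antisymm (ge_of_tendsto hlim4 ?_) bot_le
  filter_upwards [Filter.eventually_gt_atTop 0, hlim2.eventually (gt_mem_nhds hρ)] with m hm hm2
  exact hbound m hm hm2.le

end Tangency

/-! ### Indefinite Lyapunov forms -/

section ComplexForm

lemma exists_dual_eigenvector {V : Type*} [AddCommGroup V] [Module ℂ V] [FiniteDimensional ℂ V]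
    {A : Module.End ℂ V} {z : ℂ} (hz : A.HasEigenvalue z) :
    ∃ l : V →ₗ[ℂ] ℂ, l ≠ 0 ∧ ∀ x, l (A x) = z * l x := by
  have hlt : LinearMap.range (A - algebraMap ℂ (Module.End ℂ V) z) < ⊤ := by
    rw [lt_top_iff_ne_top, Ne, LinearMap.range_eq_top, ← LinearMap.injective_iff_surjective,
      ← LinearMap.ker_eq_bot, Algebra.algebraMap_eq_smul_one, ← Module.End.eigenspace_def]
    exact Module.End.hasEigenvalue_iff.1 hz
  obtain ⟨l, hl, hle⟩ := Submodule.exists_le_ker_of_lt_top _ hlt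
  refine ⟨l, hl, fun x => ?_⟩
  have : l ((A - algebraMap ℂ (Module.End ℂ V) z) x) = 0 := hle ⟨x, rfl⟩
  rw [LinearMap.sub_apply, map_sub, Module.algebraMap_end_apply, map_smul, smul_eq_mul] at this
  exact sub_eq_zero.1 this

lemma inner_smul_mul_le {a c : ℝ} (hc : 0 < c) (u v w : ℂ) :
    -(c / 2 * ‖w‖ ^ 2 + (a * ‖u‖) ^ 2 / (2 * c) * ‖v‖ ^ 2) ≤ a * inner ℝ w (v * u) := by
  have h1 : |a * inner ℝ w (v * u)| ≤ |a| * ‖u‖ * ‖v‖ * ‖w‖ := by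
    rw [abs_mul]
    have := abs_real_inner_le_norm w (v * u)
    rw [norm_mul] at this
    calc |a| * |inner ℝ w (v * u)| ≤ |a| * (‖w‖ * (‖v‖ * ‖u‖)) := by gcongr
      _ = |a| * ‖u‖ * ‖v‖ * ‖w‖ := by ring
  have h2 : |a| * ‖u‖ * ‖v‖ * ‖w‖ ≤ c / 2 * ‖w‖ ^ 2 + (a * ‖u‖) ^ 2 / (2 * c) * ‖v‖ ^ 2 := by
    have e : c / 2 * ‖w‖ ^ 2 + (a * ‖u‖) ^ 2 / (2 * c) * ‖v‖ ^ 2 - |a| * ‖u‖ * ‖v‖ * ‖w‖ =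
        (c * ‖w‖ - |a| * ‖u‖ * ‖v‖) ^ 2 / (2 * c) := by
      rw [mul_pow a, ← sq_abs a]
      field_simp
      ring
    have : 0 ≤ (c * ‖w‖ - |a| * ‖u‖ * ‖v‖) ^ 2 / (2 * c) := by positivity
    linarith
  linarith [neg_abs_le (a * inner ℝ w (v * u))]

/-- A complex operator without imaginary eigenvalues admits a nondegenerate Hermitian form,
diagonalized by the functionals `φ j` with the coefficients `s j`, that increases along the orbits of
the operator. It is built along an invariant flag: `l` is a left eigenvector, so that `ker l` is
invariant, and a large multiple of `± ‖l‖²` dominates the interaction of `ker l` with a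
complement. -/
lemma exists_hermitian_form (n : ℕ) : ∀ (V : Type*) [AddCommGroup V] [Module ℂ V]
    [FiniteDimensional ℂ V], Module.finrank ℂ V = n → ∀ A : Module.End ℂ V,
    (∀ z, A.HasEigenvalue z → z.re ≠ 0) →
    ∃ (φ : Fin n → V →ₗ[ℂ] ℂ) (s : Fin n → ℝ) (c : ℝ), 0 < c ∧
      (∀ x, c * ∑ j, ‖φ j x‖ ^ 2 ≤ ∑ j, s j * inner ℝ (φ j x) (φ j (A x))) ∧
      ∀ x, (∀ j, φ j x = 0) → x = 0 := by
  induction n with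
  | zero =>
    intro V _ _ _ hV A _
    have := Module.finrank_zero_iff.1 hV
    exact ⟨fun _ => 0, fun _ => 0, 1, one_pos, fun x => by simp, fun x _ => Subsingleton.elim _ _⟩
  | succ n ih =>
    intro V _ _ _ hV A hA
    have : Nontrivial V := Module.nontrivial_of_finrank_pos (R := ℂ) (by omega)
    obtain ⟨z, hz⟩ := Module.End.exists_eigenvalue A
    obtain ⟨l, hl0, hl⟩ := exists_dual_eigenvector hz
    have hre := hA z hz
    obtain ⟨v, hv⟩ : ∃ v, l v = 1 := by
      obtain ⟨v, hv⟩ := DFunLike.ne_iff.1 hl0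
      exact ⟨(l v)⁻¹ • v, by rw [map_smul, smul_eq_mul, inv_mul_cancel₀ hv]⟩
    set W := LinearMap.ker l
    have hWA : ∀ x ∈ W, A x ∈ W := fun x hx => by
      rw [LinearMap.mem_ker] at hx ⊢
      rw [hl, hx, mul_zero]
    have hWdim : Module.finrank ℂ W = n := by
      have h1 : Module.finrank ℂ (LinearMap.range l) + Module.finrank ℂ W = Module.finrank ℂ V :=
        LinearMap.finrank_range_add_finrank_ker l
      have h2 : LinearMap.range l = ⊤ := LinearMap.range_eq_top.2 fun w =>
        ⟨w • v, by rw [map_smul, hv, smul_eq_mul, mul_one]⟩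
      rw [h2, finrank_top, Module.finrank_self, hV] at h1
      omega
    obtain ⟨φ, s, c, hc, hφ, hφ0⟩ := ih W hWdim (A.restrict hWA) fun w hw => by
      obtain ⟨x, hx⟩ := hw.exists_hasEigenvector
      refine hA w (Module.End.hasEigenvalue_of_hasEigenvector (x := (x : V))
        ⟨Module.End.mem_eigenspace_iff.2 ?_, fun h => hx.2 (Subtype.ext h)⟩)
      exact congrArg Subtype.val hx.apply_eq_smul
    -- the projection onto `ker l` along `v`
    let p : V →ₗ[ℂ] W := LinearMap.codRestrict W (LinearMap.id - l.smulRight v) fun x => by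
      rw [LinearMap.mem_ker]
      simp [hv]
    have hp : ∀ x, (p x : V) = x - l x • v := fun x => rfl
    have hpA : ∀ x, p (A x) = A.restrict hWA (p x) + l x • p (A v) := fun x => by
      refine Subtype.ext ?_
      simp only [Submodule.coe_add, Submodule.coe_smul, LinearMap.coe_restrict_apply, hp, map_sub,
        map_smul, hl, hv]
      module
    set M := ∑ j, (s j * ‖φ j (p (A v))‖) ^ 2 / (2 * c)
    refine ⟨Fin.cons l fun j => φ j ∘ₗ p, Fin.cons ((M + c / 2) / z.re) s, c / 2, half_pos hc,
      fun x => ?_, fun x hx => ?_⟩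
    · rw [Fin.sum_univ_succ, Fin.sum_univ_succ]
      simp only [Fin.cons_zero, Fin.cons_succ, LinearMap.comp_apply, hpA x, map_add, map_smul,
        inner_add_right, mul_add, Finset.sum_add_distrib, smul_eq_mul, hl x]
      have e1 : (M + c / 2) / z.re * inner ℝ (l x) (z * l x) = (M + c / 2) * ‖l x‖ ^ 2 := by
        have : inner ℝ (l x) (z * l x) = z.re * ‖l x‖ ^ 2 := by
          rw [Complex.inner, ← Complex.normSq_eq_norm_sq, Complex.normSq_apply]
          simp
          ring
        rw [this]
        field_simp
      have e2 := hφ (p x)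
      have e3 : -(c / 2 * ∑ j, ‖φ j (p x)‖ ^ 2 + M * ‖l x‖ ^ 2) ≤
          ∑ j, s j * inner ℝ (φ j (p x)) (l x * φ j (p (A v))) := by
        rw [Finset.mul_sum, Finset.sum_mul, ← Finset.sum_add_distrib, ← Finset.sum_neg_distrib]
        exact Finset.sum_le_sum fun j _ => inner_smul_mul_le hc _ _ _
      rw [e1]
      linarith
    · have h0 : l x = 0 := hx 0
      have h1 : p x = 0 := hφ0 _ fun j => hx j.succ
      have h2 := hp x
      rw [h1, h0, zero_smul, sub_zero] at h2
      exact h2.symm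

end ComplexForm

section RealForm

open TensorProduct

variable {E : Type*} [NormedAddCommGroup E] [InnerProductSpace ℝ E]

/-- A complex eigenvector of `F` yields a real invariant plane (or line). -/
lemma IsComplexEigenvalue.exists_real_pair {F : E →L[ℝ] E} {z : ℂ}
    (hz : IsComplexEigenvalue F z) : ∃ x y : E, (x ≠ 0 ∨ y ≠ 0) ∧ F x = z.re • x - z.im • y ∧
      F y = z.im • x + z.re • y := by
  obtain ⟨v, hv⟩ := hz.exists_hasEigenvector
  let ℛ : ℂ ⊗[ℝ] E →ₗ[ℝ] E := (TensorProduct.lid ℝ E).toLinearMap ∘ₗ Complex.reLm.rTensor E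
  let ℐ : ℂ ⊗[ℝ] E →ₗ[ℝ] E := (TensorProduct.lid ℝ E).toLinearMap ∘ₗ Complex.imLm.rTensor E
  have hℛ : ∀ (w : ℂ) (x : E), ℛ (w ⊗ₜ x) = w.re • x := fun w x => by simp [ℛ]
  have hℐ : ∀ (w : ℂ) (x : E), ℐ (w ⊗ₜ x) = w.im • x := fun w x => by simp [ℐ]
  have hFℛ : ∀ t, ℛ ((F : E →ₗ[ℝ] E).baseChange ℂ t) = F (ℛ t) := fun t => by
    induction t with
    | zero => simp
    | tmul w x => simp [hℛ]
    | add a b ha hb => simp only [map_add, ha, hb]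
  have hFℐ : ∀ t, ℐ ((F : E →ₗ[ℝ] E).baseChange ℂ t) = F (ℐ t) := fun t => by
    induction t with
    | zero => simp
    | tmul w x => simp [hℐ]
    | add a b ha hb => simp only [map_add, ha, hb]
  have hsℛ : ∀ t, ℛ (z • t) = z.re • ℛ t - z.im • ℐ t := fun t => by
    induction t with
    | zero => simp
    | tmul w x => simp only [TensorProduct.smul_tmul', smul_eq_mul, hℛ, hℐ, Complex.mul_re]; module
    | add a b ha hb => simp only [smul_add, map_add, ha, hb]; module
  have hsℐ : ∀ t, ℐ (z • t) = z.im • ℛ t + z.re • ℐ t := fun t => by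
    induction t with
    | zero => simp
    | tmul w x => simp only [TensorProduct.smul_tmul', smul_eq_mul, hℛ, hℐ, Complex.mul_im]; module
    | add a b ha hb => simp only [smul_add, map_add, ha, hb]; module
  have hdec : ∀ t : ℂ ⊗[ℝ] E, t = (1 : ℂ) ⊗ₜ ℛ t + Complex.I ⊗ₜ ℐ t := fun t => by
    induction t with
    | zero => simp
    | tmul w x =>
      rw [hℛ, hℐ, TensorProduct.tmul_smul, TensorProduct.tmul_smul, TensorProduct.smul_tmul',
        TensorProduct.smul_tmul', ← TensorProduct.add_tmul]
      congr 1
      apply Complex.ext <;> simp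
    | add a b ha hb =>
      conv_lhs => rw [ha, hb]
      simp only [map_add, TensorProduct.tmul_add]
      abel
  have heq := hv.apply_eq_smul
  refine ⟨ℛ v, ℐ v, ?_, ?_, ?_⟩
  · by_contra! h
    refine hv.2 ?_
    rw [hdec v, h.1, h.2]
    simp
  · rw [← hFℛ, heq, hsℛ]
  · rw [← hFℐ, heq, hsℐ]

/-- A real-linear left eigenvector. -/
lemma IsComplexEigenvalue.exists_functional [FiniteDimensional ℝ E] {F : E →L[ℝ] E} {z : ℂ}
    (hz : IsComplexEigenvalue F z) : ∃ l : E →L[ℝ] ℂ, l ≠ 0 ∧ ∀ x, l (F x) = z * l x := by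
  obtain ⟨l, hl0, hl⟩ := exists_dual_eigenvector hz
  let l' : E →ₗ[ℝ] ℂ := (l.restrictScalars ℝ) ∘ₗ TensorProduct.mk ℝ ℂ E 1
  have hl' : ∀ x, l' x = l (1 ⊗ₜ x) := fun x => rfl
  refine ⟨LinearMap.toContinuousLinearMap l', fun h => hl0 ?_, fun x => ?_⟩
  · refine LinearMap.ext fun t => ?_
    induction t with
    | zero => simp
    | tmul w x =>
      have h1 : l' x = 0 := DFunLike.congr_fun h x
      have h2 : w ⊗ₜ[ℝ] x = w • ((1 : ℂ) ⊗ₜ[ℝ] x) := by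
        rw [TensorProduct.smul_tmul', smul_eq_mul, mul_one]
      rw [h2, map_smul, ← hl', h1]
      simp
    | add a b ha hb => rw [map_add, ha, hb, map_add]
  · change l' (F x) = z * l' x
    rw [hl', hl', ← hl]
    simp

/-- If `F` has an eigenvalue with positive real part, then there is a quadratic form that takes
positive values and grows exponentially along the orbits of `F`, with a margin that makes this
stable under perturbations of `F`. -/
lemma exists_lyapunov_form [FiniteDimensional ℝ E] {F : E →L[ℝ] E} {z : ℂ}
    (hz : IsComplexEigenvalue F z) (hre : 0 < z.re) :
    ∃ (B : E →L[ℝ] E →L[ℝ] ℝ) (μ c : ℝ), 0 < μ ∧ 0 < c ∧ (∀ x y, B x y = B y x) ∧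
      (∀ x, μ * B x x + c * ‖x‖ ^ 2 ≤ B x (F x)) ∧ ∃ x, 0 < B x x := by
  set Fc : Module.End ℂ (ℂ ⊗[ℝ] E) := (F : E →ₗ[ℝ] E).baseChange ℂ
  obtain ⟨μ, ⟨hμ0, hμz⟩, hμ⟩ : ∃ μ ∈ Ioo 0 z.re, ∀ w, Fc.HasEigenvalue w → w.re ≠ μ := by
    have hfin : (Complex.re '' {w | Fc.HasEigenvalue w}).Finite :=
      (Module.End.finite_hasEigenvalue Fc).image _
    obtain ⟨μ, hμ, hμ'⟩ := (Ioo_infinite hre).exists_notMem_finite hfin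
    exact ⟨μ, hμ, fun w hw h => hμ' ⟨w, hw, h⟩⟩
  obtain ⟨φ, s, c, hc, hφ, hφ0⟩ := exists_hermitian_form _ (ℂ ⊗[ℝ] E) rfl
    (Fc - algebraMap ℂ (Module.End ℂ (ℂ ⊗[ℝ] E)) μ) fun w hw h => by
      obtain ⟨v, hv⟩ := hw.exists_hasEigenvector
      refine hμ (w + μ) (Module.End.hasEigenvalue_of_hasEigenvector (x := v)
        ⟨Module.End.mem_eigenspace_iff.2 ?_, hv.2⟩) (by simp [h])
      have := hv.apply_eq_smul
      rw [LinearMap.sub_apply, Module.algebraMap_end_apply, sub_eq_iff_eq_add] at this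
      rw [this, add_smul]
  let ψ : ∀ j, E →L[ℝ] ℂ := fun j => LinearMap.toContinuousLinearMap
    (((φ j).restrictScalars ℝ) ∘ₗ TensorProduct.mk ℝ ℂ E 1)
  have hψ : ∀ j x, ψ j x = φ j (1 ⊗ₜ x) := fun j x => rfl
  have hψF : ∀ j x, φ j ((Fc - algebraMap ℂ (Module.End ℂ (ℂ ⊗[ℝ] E)) μ) (1 ⊗ₜ x)) =
      ψ j (F x) - μ • ψ j x := fun j x => by
    rw [LinearMap.sub_apply, Module.algebraMap_end_apply, map_sub, map_smul, hψ, hψ]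
    simp [Fc]
  obtain ⟨k, hk, hklow⟩ : ∃ k : ℝ, 0 < k ∧ ∀ x, k * ‖x‖ ^ 2 ≤ ∑ j, ‖ψ j x‖ ^ 2 := by
    let Ψ : E →ₗ[ℝ] (Fin (Module.finrank ℂ (ℂ ⊗[ℝ] E)) → ℂ) := LinearMap.pi fun j => (ψ j : E →ₗ[ℝ] ℂ)
    have hker : LinearMap.ker Ψ = ⊥ := by
      refine LinearMap.ker_eq_bot'.2 fun x hx => ?_
      have h1 : (1 : ℂ) ⊗ₜ[ℝ] x = 0 := hφ0 _ fun j => congrFun hx j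
      have h2 := congrArg ((TensorProduct.lid ℝ E).toLinearMap ∘ₗ Complex.reLm.rTensor E) h1
      simpa using h2
    obtain ⟨C, hC, hanti⟩ := LinearMap.exists_antilipschitzWith Ψ hker
    refine ⟨1 / (C : ℝ) ^ 2, by positivity, fun x => ?_⟩
    have h1 : ‖x‖ ≤ C * ‖Ψ x‖ := by
      have := hanti.le_mul_dist x 0
      rwa [map_zero, dist_zero_right, dist_zero_right] at this
    have h2 : ‖Ψ x‖ ≤ Real.sqrt (∑ j, ‖ψ j x‖ ^ 2) := by
      refine (pi_norm_le_iff_of_nonneg (Real.sqrt_nonneg _)).2 fun j => Real.le_sqrt_of_sq_le ?_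
      exact Finset.single_le_sum (f := fun j => ‖ψ j x‖ ^ 2) (fun _ _ => by positivity)
        (Finset.mem_univ j)
    have h3 : ‖Ψ x‖ ^ 2 ≤ ∑ j, ‖ψ j x‖ ^ 2 := by
      rw [← Real.sq_sqrt (Finset.sum_nonneg fun j _ => by positivity :
        0 ≤ ∑ j, ‖ψ j x‖ ^ 2)]
      gcongr
    refine le_trans ?_ h3
    rw [one_div, inv_mul_le_iff₀ (by positivity), ← mul_pow]
    gcongr
  let B : E →L[ℝ] E →L[ℝ] ℝ := ∑ j, s j • (innerSL ℝ).bilinearComp (ψ j) (ψ j)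
  have hB : ∀ x y, B x y = ∑ j, s j * inner ℝ (ψ j x) (ψ j y) := fun x y => by
    simp [B]
  have hsymm : ∀ x y, B x y = B y x := fun x y => by
    rw [hB, hB]
    exact Finset.sum_congr rfl fun j _ => by rw [real_inner_comm]
  have hlow : ∀ x, μ * B x x + (c * k) * ‖x‖ ^ 2 ≤ B x (F x) := fun x => by
    have h1 := hφ (1 ⊗ₜ x)
    simp only [hψF, ← hψ, inner_sub_right, inner_smul_right, mul_sub, Finset.sum_sub_distrib] at h1
    have h2 : ∑ j, s j * (μ * inner ℝ (ψ j x) (ψ j x)) = μ * B x x := by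
      rw [hB, Finset.mul_sum]
      exact Finset.sum_congr rfl fun j _ => by ring
    rw [h2, ← hB] at h1
    have h3 := mul_le_mul_of_nonneg_left (hklow x) hc.le
    linarith
  refine ⟨B, μ, c * k, hμ0, by positivity, hsymm, hlow, ?_⟩
  obtain ⟨x, y, hxy, hFx, hFy⟩ := hz.exists_real_pair
  have hsum : 0 < (z.re - μ) * (B x x + B y y) := by
    have h1 := hlow x
    have h2 := hlow y
    rw [hFx, map_sub, map_smul, map_smul, smul_eq_mul, smul_eq_mul] at h1
    rw [hFy, map_add, map_smul, map_smul, smul_eq_mul, smul_eq_mul, hsymm y x] at h2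
    have h3 : 0 < c * k * ‖x‖ ^ 2 + c * k * ‖y‖ ^ 2 := by
      rcases hxy with h | h
      · have := norm_pos_iff.2 h
        positivity
      · have := norm_pos_iff.2 h
        positivity
    linarith
  have hpos : 0 < B x x + B y y := (mul_pos_iff_of_pos_left (by linarith)).1 hsum
  rcases lt_or_ge 0 (B x x) with h | h
  · exact ⟨x, h⟩
  · exact ⟨y, by linarith⟩

end RealForm

/-! ### Orbits that leave a ball -/

section Escape

variable {E : Type*} [NormedAddCommGroup E] [InnerProductSpace ℝ E] [FiniteDimensional ℝ E]
variable {H : E → E} {K : NNReal} {Φ : Flow ℝ E}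

/-- For vector fields close to `F`, the form of `exists_lyapunov_form` grows along the difference of
two orbits. Hence of two points whose difference is positive for the form, at most one has a bounded
forward orbit. -/
lemma exists_forall_dense_escape {F : E →L[ℝ] E} {z : ℂ} (hz : IsComplexEigenvalue F z)
    (hre : 0 < z.re) : ∃ ε : ℝ, 0 < ε ∧ ∀ (H : E → E) (Φ : Flow ℝ E), IsFlowOf H Φ →
      (∀ x y, ‖(H x - F x) - (H y - F y)‖ ≤ ε * ‖x - y‖) → ∀ ρ : ℝ,
      IsOpen {ξ | ∃ s > 0, ρ < ‖Φ s ξ‖} ∧ Dense {ξ | ∃ s > 0, ρ < ‖Φ s ξ‖} := by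
  obtain ⟨B, μ, c, hμ, hc, hsymm, hlow, x₀, hx₀⟩ := exists_lyapunov_form hz hre
  have hB0 : 0 < ‖B‖ + 1 := by positivity
  refine ⟨c / (‖B‖ + 1), by positivity, fun H Φ hΦ hH ρ => ⟨?_, ?_⟩⟩
  · have : {ξ | ∃ s > 0, ρ < ‖Φ s ξ‖} = ⋃ s > (0 : ℝ), {ξ | ρ < ‖Φ s ξ‖} := by
      ext; simp
    rw [this]
    exact isOpen_biUnion fun s _ => isOpen_lt continuous_const (by fun_prop)
  have hgrow : ∀ x y, ∀ s, 0 ≤ s → Real.exp (2 * μ * s) * B (x - y) (x - y) ≤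
      B (Φ s x - Φ s y) (Φ s x - Φ s y) := by
    intro x y
    set d := fun s => Φ s x - Φ s y with hd
    have hder : ∀ s, HasDerivAt (fun s => B (d s) (d s))
        (2 * B (d s) (H (Φ s x) - H (Φ s y))) s := by
      intro s
      have h1 : HasDerivAt d (H (Φ s x) - H (Φ s y)) s := (hΦ x s).sub (hΦ y s)
      have h2 := (B.hasFDerivAt.comp_hasDerivAt s h1).clm_apply h1
      refine h2.congr_deriv ?_
      rw [hsymm, two_mul]
      rfl
    have hest : ∀ s, 2 * μ * B (d s) (d s) ≤ 2 * B (d s) (H (Φ s x) - H (Φ s y)) := by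
      intro s
      have h1 : H (Φ s x) - H (Φ s y) =
          F (d s) + ((H (Φ s x) - F (Φ s x)) - (H (Φ s y) - F (Φ s y))) := by
        simp only [hd, map_sub]; abel
      rw [h1, map_add]
      have h2 : |B (d s) ((H (Φ s x) - F (Φ s x)) - (H (Φ s y) - F (Φ s y)))| ≤
          c * ‖d s‖ ^ 2 := by
        refine (B.le_opNorm₂ _ _).trans ?_
        calc ‖B‖ * ‖d s‖ * ‖(H (Φ s x) - F (Φ s x)) - (H (Φ s y) - F (Φ s y))‖
            ≤ (‖B‖ + 1) * ‖d s‖ * (c / (‖B‖ + 1) * ‖d s‖) := by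
              gcongr
              · linarith
              · exact hH _ _
          _ = c * ‖d s‖ ^ 2 := by field_simp
      linarith [hlow (d s), neg_abs_le
        (B (d s) ((H (Φ s x) - F (Φ s x)) - (H (Φ s y) - F (Φ s y))))]
    have hmono : Monotone fun s => Real.exp (-(2 * μ * s)) * B (d s) (d s) := by
      have hder' : ∀ s, HasDerivAt (fun s => Real.exp (-(2 * μ * s)) * B (d s) (d s))
          (Real.exp (-(2 * μ * s)) * (2 * B (d s) (H (Φ s x) - H (Φ s y)) -
            2 * μ * B (d s) (d s))) s := by
        intro s
        have h1 : HasDerivAt (fun s => -(2 * μ * s)) (-(2 * μ)) s := by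
          exact (((hasDerivAt_id s).const_mul (2 * μ)).neg).congr_deriv (by simp)
        exact (h1.exp.mul (hder s)).congr_deriv (by ring)
      refine monotone_of_deriv_nonneg (fun s => (hder' s).differentiableAt) fun s => ?_
      rw [(hder' s).deriv]
      exact mul_nonneg (Real.exp_pos _).le (by linarith [hest s])
    intro s hs
    have := hmono hs
    simp only [mul_zero, neg_zero, Real.exp_zero, one_mul, hd, Flow.map_zero_apply] at this
    calc Real.exp (2 * μ * s) * B (x - y) (x - y)
        ≤ Real.exp (2 * μ * s) * (Real.exp (-(2 * μ * s)) *
            B (Φ s x - Φ s y) (Φ s x - Φ s y)) := by gcongr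
      _ = B (Φ s x - Φ s y) (Φ s x - Φ s y) := by
        rw [← mul_assoc, ← Real.exp_add, add_neg_cancel, Real.exp_zero, one_mul]
  have hpair : ∀ x y, 0 < B (x - y) (x - y) →
      (∃ s > 0, ρ < ‖Φ s x‖) ∨ ∃ s > 0, ρ < ‖Φ s y‖ := by
    intro x y hxy
    by_contra! h
    have hlim : Filter.Tendsto (fun s => Real.exp (2 * μ * s) * B (x - y) (x - y))
        Filter.atTop Filter.atTop :=
      (Real.tendsto_exp_atTop.comp (Filter.tendsto_id.const_mul_atTop (by positivity))).atTop_mul_const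
        hxy
    obtain ⟨s, hs, hs0⟩ := ((hlim.eventually_gt_atTop (‖B‖ * (ρ + ρ) * (ρ + ρ))).and
      (Filter.eventually_gt_atTop 0)).exists
    have h1 : ‖Φ s x - Φ s y‖ ≤ ρ + ρ :=
      (norm_sub_le _ _).trans (add_le_add (h.1 s hs0) (h.2 s hs0))
    have hρ : 0 ≤ ρ := (norm_nonneg _).trans (h.1 s hs0)
    have h2 : B (Φ s x - Φ s y) (Φ s x - Φ s y) ≤ ‖B‖ * (ρ + ρ) * (ρ + ρ) :=
      (le_abs_self _).trans ((B.le_opNorm₂ _ _).trans (by gcongr))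
    linarith [hgrow x y s hs0.le]
  intro ξ
  rw [mem_closure_iff_nhds]
  intro t ht
  have hcont : Filter.Tendsto (fun δ : ℝ => ξ + δ • x₀) (𝓝[>] 0) (𝓝 ξ) := by
    have : Continuous fun δ : ℝ => ξ + δ • x₀ := by fun_prop
    have := this.tendsto 0
    rw [zero_smul, add_zero] at this
    exact this.mono_left nhdsWithin_le_nhds
  obtain ⟨δ, hδ, hδ0⟩ := ((hcont.eventually ht).and self_mem_nhdsWithin).exists
  rcases hpair (ξ + δ • x₀) ξ (by
    rw [add_sub_cancel_left, map_smul, map_smul, smul_apply, smul_eq_mul,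
      smul_eq_mul]
    have : (0 : ℝ) < δ := hδ0
    positivity) with h | h
  · exact ⟨_, hδ, h⟩
  · exact ⟨ξ, mem_of_mem_nhds ht, h⟩

end Escape

/-! ### Density of the confined points -/

section Density

variable {E : Type*} [NormedAddCommGroup E] [InnerProductSpace ℝ E]
variable {H : E → E} {K : NNReal} {Φ : Flow ℝ E}

lemma IsComplexEigenvalue.neg {F : E →L[ℝ] E} {z : ℂ} (hz : IsComplexEigenvalue F z) :
    IsComplexEigenvalue (-F) (-z) := by
  obtain ⟨v, hv⟩ := hz.exists_hasEigenvector
  refine Module.End.hasEigenvalue_of_hasEigenvector (x := v)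
    ⟨Module.End.mem_eigenspace_iff.2 ?_, hv.2⟩
  rw [ContinuousLinearMap.toLinearMap_neg, LinearMap.baseChange_neg, LinearMap.neg_apply,
    hv.apply_eq_smul, neg_smul]

lemma IsComplexEigenvalue.nontrivial {F : E →L[ℝ] E} {z : ℂ} (hz : IsComplexEigenvalue F z) :
    Nontrivial E := by
  obtain ⟨x, y, h | h, -⟩ := hz.exists_real_pair
  exacts [⟨x, 0, h⟩, ⟨y, 0, h⟩]

lemma IsFlowOf.reverse (hΦ : IsFlowOf H Φ) : IsFlowOf (fun x => -H x) Φ.reverse := fun x t => by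
  have := (hΦ x (-t)).scomp t (hasDerivAt_neg t)
  rwa [neg_one_smul] at this

variable [FiniteDimensional ℝ E]

/-- For vector fields close to `F` and a ball of any radius, there is a dense set of initial points
whose orbits leave the ball in both directions of time and are transverse to its boundary. -/
lemma exists_forall_dense_transverse_escape {F : E →L[ℝ] E}
    (hpos : ∃ z : ℂ, IsComplexEigenvalue F z ∧ 0 < z.re)
    (hneg : ∃ z : ℂ, IsComplexEigenvalue F z ∧ z.re < 0) :
    ∃ ε : ℝ, 0 < ε ∧ ∀ (H : E → E) (K : NNReal) (Φ : Flow ℝ E), LipschitzWith K H →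
      IsFlowOf H Φ → (∀ x y, ‖(H x - F x) - (H y - F y)‖ ≤ ε * ‖x - y‖) → ∀ ρ : ℝ, 0 < ρ →
      Dense {ξ | (∃ s > 0, ρ < ‖Φ s ξ‖) ∧ (∃ s < 0, ρ < ‖Φ s ξ‖) ∧
        ∀ s, ‖Φ s ξ‖ = ρ → inner ℝ (H (Φ s ξ)) (Φ s ξ) ≠ 0} := by
  obtain ⟨z, hz, hzre⟩ := hpos
  obtain ⟨w, hw, hwre⟩ := hneg
  have := hz.nontrivial
  obtain ⟨ε₁, hε₁, h₁⟩ := exists_forall_dense_escape hz hzre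
  obtain ⟨ε₂, hε₂, h₂⟩ := exists_forall_dense_escape hw.neg (by simpa using hwre)
  refine ⟨min ε₁ ε₂, lt_min hε₁ hε₂, fun H K Φ hH hΦ hclose ρ hρ => ?_⟩
  obtain ⟨ho₁, hd₁⟩ := h₁ H Φ hΦ (fun x y => (hclose x y).trans (by gcongr; exact min_le_left _ _)) ρ
  obtain ⟨ho₂, hd₂⟩ := h₂ (fun x => -H x) Φ.reverse hΦ.reverse (fun x y => by
    have e : -H x - (-F) x - (-H y - (-F) y) = -((H x - F x) - (H y - F y)) := by
      simp only [neg_apply]; abel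
    rw [e, norm_neg]
    exact (hclose x y).trans (by gcongr; exact min_le_right _ _)) ρ
  refine (hd₁.inter_of_isOpen_left (hd₂.inter_of_isOpen_left (dense_not_tangent hH hΦ hρ) ho₂)
    ho₁).mono ?_
  rintro ξ ⟨h1, ⟨s, hs, hs'⟩, h3⟩
  exact ⟨h1, ⟨-s, neg_lt_zero.2 hs, hs'⟩, h3⟩

lemma mem_closure_sphere {G : Set E} (hG : Dense G) {ρ : ℝ} (hρ : 0 < ρ) {ξ : E} {η : ℝ}
    (h : ‖ξ‖ ^ 2 + η ^ 2 = ρ ^ 2) :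
    (ξ, η) ∈ closure {x : E × ℝ | x.1 ∈ G ∧ ‖x.1‖ ^ 2 + x.2 ^ 2 = ρ ^ 2} := by
  obtain ⟨σ, hσ, hση⟩ : ∃ σ : ℝ, σ ^ 2 = 1 ∧ σ * |η| = η := by
    rcases le_total 0 η with h0 | h0
    · exact ⟨1, by norm_num, by rw [abs_of_nonneg h0, one_mul]⟩
    · exact ⟨-1, by norm_num, by rw [abs_of_nonpos h0, neg_one_mul, neg_neg]⟩
  let f : E → E × ℝ := fun x => (x, σ * Real.sqrt (ρ ^ 2 - ‖x‖ ^ 2))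
  have hf : Continuous f := by fun_prop
  have hfξ : f ξ = (ξ, η) := by
    simp only [f]
    rw [show ρ ^ 2 - ‖ξ‖ ^ 2 = η ^ 2 by linarith, Real.sqrt_sq_eq_abs, hση]
  have hξ : ξ ∈ closure (Metric.ball (0 : E) ρ ∩ G) := by
    refine closure_minimal (hG.open_subset_closure_inter Metric.isOpen_ball) isClosed_closure ?_
    rw [closure_ball _ hρ.ne', mem_closedBall_zero_iff]
    exact abs_le_of_sq_le_sq' (by nlinarith [sq_nonneg η]) hρ.le |>.2
  rw [← hfξ]
  refine map_mem_closure hf hξ fun x hx => ⟨hx.2, ?_⟩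
  have hx1 : ‖x‖ < ρ := mem_ball_zero_iff.1 hx.1
  rw [mul_pow, hσ, one_mul, Real.sq_sqrt (by nlinarith [norm_nonneg x])]
  simp [f]

/-- A condition on `b = (u, ξ, η)` that is implied, on each positive level `ρ²` of the energy, by
`ξ` lying in a dense set `G ρ`, holds on a dense subset of the phase space. The reason is that the
energy sphere is the union of two graphs over the ball of radius `ρ` in `𝔤₀`. -/
lemma dense_of_forall_dense {Γ : Submodule ℤ E} {P : Set (TM Γ)}
    (hP : ∀ p q : TM Γ, energy Γ p = energy Γ q → p ∈ P → q ∈ P)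
    (hP0 : Dense {p : P | 0 < energy Γ p}) {G : ℝ → Set E} (hG : ∀ ρ > 0, Dense (G ρ))
    {U : Set (ℝ × E × ℝ)}
    (hU : ∀ b, 0 < reducedEnergy b → b.2.1 ∈ G (Real.sqrt (reducedEnergy b)) → b ∈ U) :
    Dense {p : P | (p : TM Γ).2 ∈ U} := by
  refine Dense.of_closure (hP0.mono ?_)
  rintro ⟨⟨w, u, ξ, η⟩, hp⟩ h0
  replace h0 : 0 < ‖ξ‖ ^ 2 + η ^ 2 := h0
  set ρ := Real.sqrt (‖ξ‖ ^ 2 + η ^ 2) with hρ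
  have hρ2 : ρ ^ 2 = ‖ξ‖ ^ 2 + η ^ 2 := Real.sq_sqrt h0.le
  have hρ0 : 0 < ρ := Real.sqrt_pos.2 h0
  rw [closure_subtype]
  refine map_mem_closure (f := fun x : E × ℝ => ((w, u, x) : TM Γ)) (by fun_prop)
    (mem_closure_sphere (hG ρ hρ0) hρ0 hρ2.symm) fun x hx => ?_
  have hxe : reducedEnergy (u, x) = ‖ξ‖ ^ 2 + η ^ 2 := hx.2.trans hρ2
  have hxU : ((u, x) : ℝ × E × ℝ) ∈ U := hU _ (by rwa [hxe]) (by rw [hxe]; exact hx.1)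
  exact ⟨⟨(w, u, x), hP (w, u, ξ, η) _ hxe.symm hp⟩, hxU, rfl⟩

lemma dense_energy_pos (Γ : Submodule ℤ E) :
    Dense {p : (univ : Set (TM Γ)) | 0 < energy Γ p} := by
  have hopen : IsOpenMap fun p : (univ : Set (TM Γ)) => (p : TM Γ).2.2.2 :=
    isOpenMap_snd.comp (isOpenMap_snd.comp (isOpenMap_snd.comp isOpen_univ.isOpenMap_subtype_val))
  refine ((dense_compl_singleton (0 : ℝ)).preimage hopen).mono fun p hp => ?_
  have : (p : TM Γ).2.2.2 ≠ 0 := hp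
  change 0 < energy Γ p
  unfold energy
  positivity

end Density

/-! ### Robust integrability -/

section Robust

variable {E : Type*} [NormedAddCommGroup E] [InnerProductSpace ℝ E] [FiniteDimensional ℝ E]

/-- A vector field that is `C^1`-close to `F` on a convex set coincides there with a vector field on
the whole space that is close to `F` in the Lipschitz sense. -/
lemma exists_lipschitz_extension {F : E →L[ℝ] E} {H : E → E} {D : Set E} (hD : Convex ℝ D)
    {ε : ℝ} (hε : 0 ≤ ε) (hH : DifferentiableOn ℝ H D) (hclose : IsC1Close ε D F H) :
    ∃ (H' : E → E) (K : NNReal), LipschitzWith K H' ∧ EqOn H' H D ∧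
      ∀ x y, ‖(H' x - F x) - (H' y - F y)‖ ≤ lipschitzExtensionConstant E * ε * ‖x - y‖ := by
  have hlip : LipschitzOnWith ε.toNNReal (fun x => H x - F x) D := by
    refine LipschitzOnWith.of_dist_le_mul fun x hx y hy => ?_
    rw [dist_eq_norm, dist_eq_norm, Real.coe_toNNReal _ hε]
    exact hD.norm_image_sub_le_of_norm_hasFDerivWithin_le
      (fun x hx => (hH x hx).hasFDerivWithinAt.sub F.hasFDerivWithinAt)
      (fun x hx => (hclose x hx).2.le) hy hx
  obtain ⟨g, hg, hgeq⟩ := hlip.extend_finite_dimension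
  refine ⟨fun x => F x + g x, _, F.lipschitz.add hg, fun x hx => ?_, fun x y => ?_⟩
  · simp only [← hgeq hx, add_sub_cancel]
  · have := hg.dist_le_mul x y
    rw [dist_eq_norm, dist_eq_norm, NNReal.coe_mul, Real.coe_toNNReal _ hε] at this
    simpa only [add_sub_cancel_left] using this

/-- Integrability of the `L`-`H` system on a union `P` of energy levels, for `H` close to `F` on a
convex set `D` that contains the components `ξ` of the points of `P`. -/
lemma exists_forall_isIntegrable {F : E →L[ℝ] E}
    (hpos : ∃ z : ℂ, IsComplexEigenvalue F z ∧ 0 < z.re)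
    (hneg : ∃ z : ℂ, IsComplexEigenvalue F z ∧ z.re < 0) :
    ∃ ε > (0 : ℝ), ∀ (r : ℕ∞), 1 ≤ r → ∀ (D : Set E), Convex ℝ D →
      ∀ (Γ : Submodule ℤ E) [DiscreteTopology Γ] [IsZLattice ℝ Γ] (P : Set (TM Γ)),
      (∀ p q : TM Γ, energy Γ p = energy Γ q → p ∈ P → q ∈ P) →
      Dense {p : P | 0 < energy Γ p} → (∀ p ∈ P, p.2.2.1 ∈ D) → ∀ (L : E →L[ℝ] E) (H : E → E),
      ContDiffOn ℝ r H D → IsC1Close ε D F H →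
      ∃ Ψ : Flow ℝ P, IsLFFlow Γ L H P Ψ ∧ IsIntegrable r Γ P Ψ := by
  obtain ⟨ε, hε, hdense⟩ := exists_forall_dense_transverse_escape hpos hneg
  have hC : (0 : ℝ) < lipschitzExtensionConstant E := lipschitzExtensionConstant_pos E
  -- the extension to the whole space costs the factor `lipschitzExtensionConstant E`
  refine ⟨ε / lipschitzExtensionConstant E, by positivity, ?_⟩
  intro r hr D hD Γ _ _ P hP hP0 hPD L H hH hclose
  obtain ⟨H', K, hH', heq, hdist⟩ := exists_lipschitz_extension hD (by positivity)
    (hH.differentiableOn (by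
      have : r ≠ 0 := (zero_lt_one.trans_le hr).ne'
      exact_mod_cast this)) hclose
  rw [mul_div_cancel₀ _ hC.ne'] at hdist
  obtain ⟨Φ, hΦ, -⟩ := exists_flow_of_lipschitz hH'
  obtain ⟨φ, hφ⟩ := exists_reducedFlow hH'
  refine ⟨_, isLFFlow_skewFlow Γ hφ L hP (fun p hp => heq (hPD p hp)),
    torusFamily Γ P φ {b | IsConfined H' Φ b},
    isTorusFamily_torusFamily hr hH' hΦ hφ L Γ hP (fun p hp => ?_) (isOpen_setOf_isConfined hH')
      (fun b hb t => hb.flow hH' hΦ hφ t) (fun b hb => hb)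
      (dense_of_forall_dense hP hP0 (fun ρ hρ => hdense H' K Φ hH' hΦ hdist ρ hρ) ?_)⟩
  · refine contDiff_reducedFlow hφ hH heq fun t => ?_
    exact hPD _ (isInvariant_skewFlow Γ hφ L hP t hp)
  · rintro b hb ⟨⟨β, hβ, hβ'⟩, ⟨α, hα, hα'⟩, hreg⟩
    have hsq : ∀ s, Real.sqrt (reducedEnergy b) < ‖Φ s b.2.1‖ →
        reducedEnergy b < ‖Φ s b.2.1‖ ^ 2 := fun s hs => Real.lt_sq_of_sqrt_lt hs
    refine ⟨α, β, hα, hβ, hsq α hα', hsq β hβ', fun s _ hs => hreg s ?_⟩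
    rw [← hs, Real.sqrt_sq (norm_nonneg _)]

end Robust

/-! ### The quadratic system -/

section Quadratic

variable {E : Type*} [NormedAddCommGroup E] [InnerProductSpace ℝ E] [FiniteDimensional ℝ E]
variable {F : E →L[ℝ] E} {Φ : Flow ℝ E} {l m : E →L[ℝ] ℂ} {z w : ℂ}

lemma flow_eq_exp (hΦ : IsFlowOf F Φ) (s : ℝ) (x : E) : Φ s x = NormedSpace.exp (s • F) x := by
  have := integralCurve_unique F.lipschitz (hΦ x) (d := fun s => NormedSpace.exp (s • F) x)
    (fun t => (hasDerivAt_exp_smul_const' F t).clm_apply (hasDerivAt_const t x) |>.congr_deriv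
      (by simp)) (t₀ := 0) (by simp)
  exact congrFun this s

lemma norm_functional_flow (hΦ : IsFlowOf F Φ) (hl : ∀ x, l (F x) = z * l x) (s : ℝ) (x : E) :
    ‖l (Φ s x)‖ = Real.exp (s * z.re) * ‖l x‖ := by
  have h1 : ∀ t : ℝ, HasDerivAt (fun s => l (Φ s x)) (z * l (Φ t x)) t := fun t => by
    rw [← hl]
    exact l.hasFDerivAt.comp_hasDerivAt t (hΦ x t)
  have h2 : ∀ t : ℝ, HasDerivAt (fun s : ℝ => Complex.exp (s * z) * l x)
      (z * (Complex.exp (t * z) * l x)) t := fun t => by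
    have : HasDerivAt (fun s : ℝ => (s : ℂ) * z) z t := by
      simpa using (Complex.ofRealCLM.hasDerivAt (x := t)).mul_const z
    exact (this.cexp.mul_const (l x)).congr_deriv (by ring)
  have := congrFun (integralCurve_unique (X := fun y : ℂ => z * y) (K := ‖z‖₊)
    (LipschitzWith.of_dist_le_mul fun y y' => by
      rw [dist_eq_norm, dist_eq_norm, ← mul_sub, norm_mul, coe_nnnorm]) h1 h2 (t₀ := 0) (by simp)) s
  rw [this, norm_mul, Complex.norm_exp]
  simp

lemma exists_forall_lt_norm_flow (hΦ : IsFlowOf F Φ) (hl : ∀ x, l (F x) = z * l x)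
    (hz : 0 < z.re) {ξ : E} (hξ : l ξ ≠ 0) (R : ℝ) :
    ∃ S > 0, ∀ᶠ x in 𝓝 ξ, ∀ s ≥ S, R < ‖Φ s x‖ := by
  have hlim : Filter.Tendsto (fun s => Real.exp (s * z.re) * ‖l ξ‖) Filter.atTop Filter.atTop :=
    (Real.tendsto_exp_atTop.comp (Filter.tendsto_id.atTop_mul_const hz)).atTop_mul_const
      (norm_pos_iff.2 hξ)
  obtain ⟨S, hS, hS0⟩ := ((hlim.eventually_gt_atTop (‖l‖ * R)).and
    (Filter.eventually_gt_atTop 0)).exists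
  refine ⟨S, hS0, ?_⟩
  have hev : ∀ᶠ x in 𝓝 ξ, ‖l‖ * R < Real.exp (S * z.re) * ‖l x‖ :=
    continuousAt_const.eventually_lt (by fun_prop) hS
  filter_upwards [hev] with x hx s hs
  refine lt_of_mul_lt_mul_left (hx.trans_le ?_) (norm_nonneg l)
  calc Real.exp (S * z.re) * ‖l x‖ ≤ Real.exp (s * z.re) * ‖l x‖ := by gcongr
    _ = ‖l (Φ s x)‖ := (norm_functional_flow hΦ hl s x).symm
    _ ≤ ‖l‖ * ‖Φ s x‖ := l.le_opNorm _

/-- The points `b = (u, ξ, η)` for which `ξ` is not annihilated by the left eigenvectors `l` and `m`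
and the whole orbit of `ξ` is transverse to the sphere of radius `√h`, where `h` is the energy of
`b`. Unlike `IsConfined`, this depends only on the common level set of the first integrals. -/
def regularSet (F : E →L[ℝ] E) (Φ : Flow ℝ E) (l m : E →L[ℝ] ℂ) : Set (ℝ × E × ℝ) :=
  {b | l b.2.1 ≠ 0 ∧ m b.2.1 ≠ 0 ∧
    ∀ s, ‖Φ s b.2.1‖ ^ 2 = reducedEnergy b → inner ℝ (F (Φ s b.2.1)) (Φ s b.2.1) ≠ 0}

lemma mem_regularSet_of_mem_reducedLevel (hΦ : IsFlowOf F Φ) (hl : ∀ x, l (F x) = z * l x)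
    (hm : ∀ x, m (F x) = w * m x) {b c : ℝ × E × ℝ} (hb : b ∈ regularSet F Φ l m)
    (hc : c ∈ reducedLevel Φ b) : c ∈ regularSet F Φ l m := by
  have h : ∀ {k : E →L[ℝ] ℂ} {v : ℂ}, (∀ x, k (F x) = v * k x) → k b.2.1 ≠ 0 → k c.2.1 ≠ 0 := by
    intro k v hk h
    rw [hc.2, ← norm_ne_zero_iff, norm_functional_flow hΦ hk]
    exact mul_ne_zero (Real.exp_ne_zero _) (norm_ne_zero_iff.2 h)
  refine ⟨h hl hb.1, h hm hb.2.1, fun s => ?_⟩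
  rw [hc.1, hc.2, ← Flow.map_add]
  exact hb.2.2 _

/-- Near a point `b` of the regular set, all orbits stay outside of the ball of radius `√h` for
`|s| ≥ S`. -/
lemma exists_forall_lt_norm_sq_flow (hΦ : IsFlowOf F Φ) (hl : ∀ x, l (F x) = z * l x)
    (hz : 0 < z.re) (hm : ∀ x, m (F x) = w * m x) (hw : w.re < 0) {b : ℝ × E × ℝ}
    (hb : b ∈ regularSet F Φ l m) :
    ∃ S > 0, ∀ᶠ c in 𝓝 b, ∀ s, S ≤ |s| → reducedEnergy c < ‖Φ s c.2.1‖ ^ 2 := by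
  set R := Real.sqrt (reducedEnergy b + 1)
  obtain ⟨S₁, hS₁, h₁⟩ := exists_forall_lt_norm_flow hΦ hl hz hb.1 R
  obtain ⟨S₂, hS₂, h₂⟩ := exists_forall_lt_norm_flow (F := -F) (z := -w) hΦ.reverse
    (fun x => by rw [neg_apply, map_neg, hm, neg_mul]) (by simpa using hw) hb.2.1 R
  have hcont : ContinuousAt (fun c : ℝ × E × ℝ => c.2.1) b := by fun_prop
  have hE : ∀ᶠ c in 𝓝 b, reducedEnergy c < reducedEnergy b + 1 :=
    continuous_reducedEnergy.continuousAt.eventually_lt_const (lt_add_one _)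
  refine ⟨max S₁ S₂, lt_max_of_lt_left hS₁, ?_⟩
  filter_upwards [hcont.eventually h₁, hcont.eventually h₂, hE] with c hc₁ hc₂ hc s hs
  have hR : R < ‖Φ s c.2.1‖ := by
    rcases le_abs.1 hs with h | h
    · exact hc₁ s ((le_max_left _ _).trans h)
    · simpa using hc₂ (-s) ((le_max_right _ _).trans h)
  exact hc.trans (Real.lt_sq_of_sqrt_lt hR)

lemma isOpen_regularSet (hΦ : IsFlowOf F Φ) (hl : ∀ x, l (F x) = z * l x)
    (hz : 0 < z.re) (hm : ∀ x, m (F x) = w * m x) (hw : w.re < 0) :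
    IsOpen (regularSet F Φ l m) := by
  rw [isOpen_iff_mem_nhds]
  intro b hb
  obtain ⟨S, hS, hev⟩ := exists_forall_lt_norm_sq_flow hΦ hl hz hm hw hb
  have h1 : ∀ᶠ c in 𝓝 b, l c.2.1 ≠ 0 :=
    (by fun_prop : ContinuousAt (fun c : ℝ × E × ℝ => l c.2.1) b).eventually_ne hb.1
  have h2 : ∀ᶠ c in 𝓝 b, m c.2.1 ≠ 0 :=
    (by fun_prop : ContinuousAt (fun c : ℝ × E × ℝ => m c.2.1) b).eventually_ne hb.2.1
  filter_upwards [h1, h2, hev, eventually_not_tangent F.lipschitz (α := -S) (β := S)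
    fun s _ => hb.2.2 s] with c hc1 hc2 hc3 hc4
  refine ⟨hc1, hc2, fun s hs => ?_⟩
  by_cases h : S ≤ |s|
  · exact absurd hs (hc3 s h).ne'
  · exact hc4 s (abs_le.1 (not_le.1 h).le) hs

lemma isConfined_of_mem_regularSet (hΦ : IsFlowOf F Φ) (hl : ∀ x, l (F x) = z * l x)
    (hz : 0 < z.re) (hm : ∀ x, m (F x) = w * m x) (hw : w.re < 0) {b : ℝ × E × ℝ}
    (hb : b ∈ regularSet F Φ l m) : IsConfined F Φ b := by
  obtain ⟨S, hS, hev⟩ := exists_forall_lt_norm_sq_flow hΦ hl hz hm hw hb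
  exact ⟨-S, S, neg_lt_zero.2 hS, hS, hev.self_of_nhds _ (by rw [abs_neg]; exact le_abs_self S),
    hev.self_of_nhds _ (le_abs_self S), fun s _ => hb.2.2 s⟩

lemma isCompact_reducedLevel (hΦ : IsFlowOf F Φ) (hl : ∀ x, l (F x) = z * l x)
    (hz : 0 < z.re) (hm : ∀ x, m (F x) = w * m x) (hw : w.re < 0) {b : ℝ × E × ℝ}
    (hb : b ∈ regularSet F Φ l m) : IsCompact (reducedLevel Φ b) := by
  obtain ⟨S, hS, hev⟩ := exists_forall_lt_norm_sq_flow hΦ hl hz hm hw hb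
  set R := Real.sqrt (reducedEnergy b)
  refine IsCompact.of_isClosed_subset
    (isCompact_Icc.prod (isCompact_closedBall (0 : E × ℝ) R) :
      IsCompact (Icc (b.1 - S) (b.1 + S) ×ˢ Metric.closedBall (0 : E × ℝ) R)) ?_ fun c hc => ⟨?_, ?_⟩
  · exact (isClosed_eq continuous_reducedEnergy continuous_const).inter
      (isClosed_eq (by fun_prop) (by fun_prop))
  · have h1 : ‖Φ (c.1 - b.1) b.2.1‖ ^ 2 ≤ reducedEnergy b := by
      rw [← hc.1, ← hc.2, reducedEnergy]
      linarith [sq_nonneg c.2.2]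
    have h2 : |c.1 - b.1| < S := by
      by_contra! h
      exact absurd (hev.self_of_nhds _ h) (not_lt.2 h1)
    rw [abs_lt] at h2
    exact ⟨by linarith [h2.1], by linarith [h2.2]⟩
  · rw [mem_closedBall_zero_iff]
    refine norm_snd_le_of_reducedEnergy_le (Real.sqrt_nonneg _) ?_
    rw [Real.sq_sqrt (reducedEnergy_nonneg b), hc.1]

lemma dense_setOf_functional_ne_zero (hl : l ≠ 0) : Dense {x | l x ≠ 0} := by
  have h : interior (LinearMap.ker (l : E →ₗ[ℝ] ℂ) : Set E) = ∅ := by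
    by_contra hne
    refine hl (ContinuousLinearMap.ext fun x => ?_)
    have : x ∈ LinearMap.ker (l : E →ₗ[ℝ] ℂ) := by
      rw [Submodule.eq_top_of_nonempty_interior' _ (nonempty_iff_ne_empty.2 hne)]
      trivial
    exact this
  exact interior_eq_empty_iff_dense_compl.1 h

lemma levelSet_eq (hΦ : IsFlowOf F Φ) (Γ : Submodule ℤ E) {P : Set (TM Γ)} (p : P) :
    levelSet Γ F p = {q : P | (q : TM Γ).2 ∈ reducedLevel Φ (p : TM Γ).2} := by
  ext q
  have h : firstIntegral Γ F q = firstIntegral Γ F p ↔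
      (q : TM Γ).2.2.1 = Φ ((q : TM Γ).2.1 - (p : TM Γ).2.1) (p : TM Γ).2.2.1 := by
    simp only [firstIntegral, ← flow_eq_exp hΦ]
    constructor
    · intro h
      have := congrArg (Φ (q : TM Γ).2.1) h
      rwa [← Flow.map_add, ← Flow.map_add, add_neg_cancel, Flow.map_zero_apply,
        ← sub_eq_add_neg] at this
    · intro h
      rw [h, ← Flow.map_add, sub_eq_add_neg, neg_add_cancel_left]
  exact (and_congr_left' h).trans and_comm

lemma analyticOnNhd_firstIntegral (Γ : Submodule ℤ E) (F : E →L[ℝ] E) :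
    AnalyticOnNhd ℝ (fun p : TG E => firstIntegral Γ F (proj Γ p)) univ :=
  contDiff_omega_iff_analyticOnNhd.1
    (contDiff_exp_smul_apply F contDiff_snd.fst.neg contDiff_snd.snd.fst)

lemma analyticOnNhd_energy (Γ : Submodule ℤ E) :
    AnalyticOnNhd ℝ (fun p : TG E => energy Γ (proj Γ p)) univ :=
  contDiff_omega_iff_analyticOnNhd.1
    ((contDiff_snd.snd.fst.norm_sq ℝ).add (contDiff_snd.snd.snd.pow 2))

/-- Integrability of the quadratic system, by the components of the level sets of the first
integrals. -/
lemma exists_isTorusFamily_quadratic (hpos : ∃ z : ℂ, IsComplexEigenvalue F z ∧ 0 < z.re)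
    (hneg : ∃ z : ℂ, IsComplexEigenvalue F z ∧ z.re < 0) (Γ : Submodule ℤ E) [DiscreteTopology Γ]
    [IsZLattice ℝ Γ] (L : E →L[ℝ] E) :
    ∃ Ψ : Flow ℝ (univ : Set (TM Γ)), IsLFFlow Γ L F univ Ψ ∧
      (∀ t p, firstIntegral Γ F (Ψ t p) = firstIntegral Γ F p ∧
        energy Γ (Ψ t p) = energy Γ p) ∧
      ∃ 𝒯 : Set (Set (univ : Set (TM Γ))), IsTorusFamily (⊤ : ℕ∞) Γ univ Ψ 𝒯 ∧
        (∀ T ∈ 𝒯, ∀ p ∈ T, T = connectedComponentIn (levelSet Γ F p) p) ∧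
        ∀ p ∈ ⋃₀ 𝒯, ∃ 𝒮 ⊆ 𝒯, 𝒮.Finite ∧ levelSet Γ F p = ⋃₀ 𝒮 := by
  obtain ⟨z, hzF, hz⟩ := hpos
  obtain ⟨w, hwF, hw⟩ := hneg
  have := hzF.nontrivial
  obtain ⟨l, hl0, hl⟩ := hzF.exists_functional
  obtain ⟨m, hm0, hm⟩ := hwF.exists_functional
  obtain ⟨Φ, hΦ, -⟩ := exists_flow_of_lipschitz F.lipschitz
  obtain ⟨φ, hφ⟩ := exists_reducedFlow F.lipschitz
  have hP : ∀ p q : TM Γ, energy Γ p = energy Γ q → p ∈ (univ : Set (TM Γ)) → q ∈ univ :=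
    fun _ q _ _ => mem_univ q
  have hmem := reducedFlow_mem_reducedLevel F.lipschitz hΦ hφ
  set U := regularSet F Φ l m with hU
  have hUinv : ∀ b ∈ U, ∀ t, φ t b ∈ U := fun b hb t =>
    mem_regularSet_of_mem_reducedLevel hΦ hl hm hb (hmem b t)
  have hUc : ∀ b ∈ U, IsConfined F Φ b := fun b hb =>
    isConfined_of_mem_regularSet hΦ hl hz hm hw hb
  have hUd : Dense {p : (univ : Set (TM Γ)) | (p : TM Γ).2 ∈ U} := by
    refine dense_of_forall_dense hP (dense_energy_pos Γ)
      (G := fun ρ => {x | l x ≠ 0} ∩ ({x | m x ≠ 0} ∩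
        {x | ∀ s, ‖Φ s x‖ = ρ → inner ℝ (F (Φ s x)) (Φ s x) ≠ 0}))
      (fun ρ hρ => ?_) fun b _ hb => ?_
    · exact (dense_setOf_functional_ne_zero hl0).inter_of_isOpen_left
        ((dense_setOf_functional_ne_zero hm0).inter_of_isOpen_left
          (dense_not_tangent F.lipschitz hΦ hρ) (isOpen_ne_fun m.continuous continuous_const))
        (isOpen_ne_fun l.continuous continuous_const)
    · refine ⟨hb.1, hb.2.1, fun s hs => hb.2.2 s ?_⟩
      rw [← hs, Real.sqrt_sq (norm_nonneg _)]
  have hfam := isTorusFamily_torusFamily (r := ⊤) le_top F.lipschitz hΦ hφ L Γ hP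
    (fun p _ => contDiff_reducedFlow hφ (contDiffOn_univ.2 F.contDiff) (eqOn_refl _ _)
      fun _ => mem_univ _) (isOpen_regularSet hΦ hl hz hm hw) hUinv hUc hUd
  refine ⟨_, isLFFlow_skewFlow Γ hφ L hP fun _ _ => rfl, fun t p => ?_, torusFamily Γ univ φ U,
    hfam, ?_, ?_⟩
  · have h : (skewFlow Γ L φ).restrict (isInvariant_skewFlow Γ hφ L hP) t p ∈ levelSet Γ F p := by
      rw [levelSet_eq hΦ]
      exact hmem (p : TM Γ).2 t
    exact h
  · rintro _ ⟨p, hp, rfl⟩ q ⟨t, hq⟩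
    have h1 : orbitTorus Γ univ φ (p : TM Γ).2 = orbitTorus Γ univ φ (q : TM Γ).2 :=
      orbitTorus_eq Γ univ (s := t) (t := 0) (by rw [Flow.map_zero_apply, hq])
    have hqU : (q : TM Γ).2 ∈ U := hq ▸ hUinv _ hp t
    rw [h1, levelSet_eq hΦ]
    exact orbitTorus_eq_connectedComponentIn F.lipschitz hΦ hφ (hUc _ hqU)
      (hfam.torus _ ⟨q, hqU, rfl⟩)
  · intro p hp
    rw [sUnion_torusFamily Γ univ hUinv] at hp
    have hlev : ∀ c ∈ reducedLevel Φ (p : TM Γ).2, c ∈ U := fun c hc =>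
      mem_regularSet_of_mem_reducedLevel hΦ hl hm hp hc
    refine ⟨orbitTorus Γ univ φ '' reducedLevel Φ (p : TM Γ).2, ?_,
      finite_orbitTorus_of_isCompact F.lipschitz hΦ hφ Γ univ
        (isCompact_reducedLevel hΦ hl hz hm hw hp) fun c hc => hUc c (hlev c hc), ?_⟩
    · rintro _ ⟨c, hc, rfl⟩
      exact ⟨⟨((0 : E ⧸ Γ), c), mem_univ _⟩, hlev c hc, rfl⟩
    · rw [levelSet_eq hΦ]
      ext q
      constructor
      · intro hq
        exact ⟨_, ⟨_, hq, rfl⟩, 0, (Flow.map_zero_apply _ _).symm⟩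
      · rintro ⟨_, ⟨c, hc, rfl⟩, t, ht⟩
        change (q : TM Γ).2 ∈ reducedLevel Φ (p : TM Γ).2
        rw [ht, ← reducedLevel_eq_of_mem hc]
        exact hmem c t

end Quadratic

end LF

end

theorem theorem6p2 {E : Type*} [NormedAddCommGroup E] [InnerProductSpace ℝ E]
    [FiniteDimensional ℝ E] (F : E →L[ℝ] E)
    (hpos : ∃ z : ℂ, LF.IsComplexEigenvalue F z ∧ 0 < z.re)
    (hneg : ∃ z : ℂ, LF.IsComplexEigenvalue F z ∧ z.re < 0) :
    (∀ (Γ : Submodule ℤ E) [DiscreteTopology Γ] [IsZLattice ℝ Γ] (L : E →L[ℝ] E),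
      ∃ Ψ : Flow ℝ (Set.univ : Set (LF.TM Γ)), LF.IsLFFlow Γ L F Set.univ Ψ ∧
        -- real-analytic first integrals
        AnalyticOnNhd ℝ (fun p : LF.TG E => LF.firstIntegral Γ F (LF.proj Γ p)) Set.univ ∧
        AnalyticOnNhd ℝ (fun p : LF.TG E => LF.energy Γ (LF.proj Γ p)) Set.univ ∧
        (∀ t p, LF.firstIntegral Γ F (Ψ t p) = LF.firstIntegral Γ F p ∧
          LF.energy Γ (Ψ t p) = LF.energy Γ p) ∧
        -- integrability, by tori that are the components of the common level sets
        ∃ 𝒯 : Set (Set (Set.univ : Set (LF.TM Γ))), LF.IsTorusFamily (⊤ : ℕ∞) Γ Set.univ Ψ 𝒯 ∧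
          (∀ T ∈ 𝒯, ∀ p ∈ T, T = connectedComponentIn (LF.levelSet Γ F p) p) ∧
          ∀ p ∈ ⋃₀ 𝒯, ∃ 𝒮 ⊆ 𝒯, 𝒮.Finite ∧ LF.levelSet Γ F p = ⋃₀ 𝒮) ∧
    -- robustness, on `TM` and on `SM`
    (∃ ε > (0 : ℝ), ∀ (r : ℕ∞), 1 ≤ r →
      ∀ (Γ : Submodule ℤ E) [DiscreteTopology Γ] [IsZLattice ℝ Γ] (L : E →L[ℝ] E) (H : E → E),
        (ContDiff ℝ r H → LF.IsC1Close ε Set.univ F H →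
          ∃ Ψ : Flow ℝ (Set.univ : Set (LF.TM Γ)), LF.IsLFFlow Γ L H Set.univ Ψ ∧
            LF.IsIntegrable r Γ Set.univ Ψ) ∧
        (ContDiffOn ℝ r H (Metric.closedBall 0 1) →
          LF.IsC1Close ε (Metric.closedBall 0 1) F H →
          ∃ Ψ : Flow ℝ (LF.SM Γ), LF.IsLFFlow Γ L H (LF.SM Γ) Ψ ∧
            LF.IsIntegrable r Γ (LF.SM Γ) Ψ)) := by
  refine ⟨fun Γ _ _ L => ?_, ?_⟩
  · obtain ⟨Ψ, hΨ, hinv, h⟩ := LF.exists_isTorusFamily_quadratic hpos hneg Γ L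
    exact ⟨Ψ, hΨ, LF.analyticOnNhd_firstIntegral Γ F, LF.analyticOnNhd_energy Γ, hinv, h⟩
  · obtain ⟨ε, hε, h⟩ := LF.exists_forall_isIntegrable hpos hneg
    refine ⟨ε, hε, fun r hr Γ _ _ L H => ⟨fun hH hclose => ?_, fun hH hclose => ?_⟩⟩
    · exact h r hr univ convex_univ Γ univ (fun _ q _ _ => mem_univ q) (LF.dense_energy_pos Γ)
        (fun _ _ => mem_univ _) L H hH.contDiffOn hclose
    · refine h r hr _ (convex_closedBall 0 1) Γ (LF.SM Γ) (fun p q hpq hp => hpq.symm.trans hp)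
        ?_ (fun p hp => ?_) L H hH hclose
      · convert! dense_univ
        refine eq_univ_of_forall fun p => ?_
        have h1 : LF.energy Γ p = 1 := p.2
        change 0 < LF.energy Γ p
        rw [h1]
        exact one_pos
      · rw [mem_closedBall_zero_iff]
        have h1 : ‖p.2.2.1‖ ^ 2 + p.2.2.2 ^ 2 = 1 := hp
        exact abs_le_of_sq_le_sq' (by nlinarith [sq_nonneg p.2.2.2]) zero_le_one |>.2
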